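/- Let $\Sigma$ be a closed Riemann surface, i.e. a compact connected complex manifold of complex dimension $1$, let $G$ be a complex Lie group whose (finite-dimensional, complex) Lie algebra $\mathfrak g$ is simple, and let $\langle\cdot,\cdot\rangle$ be an invariant inner product on $\mathfrak g$, i.e. a non-degenerate symmetric $\mathbb C$-bilinear form with $\langle [x,y],z\rangle=-\langle y,[x,z]\rangle$. Let $\eta$ be a holomorphic $1$-form on $\Sigma$. Let $C^\infty(\Sigma,G)$ be the group of smooth maps under pointwise multiplication, and for $f\in C^\infty(\Sigma,G)$ let $f^{-1}.\bar\partial f$ denote the $(0,1)$-part of the left logarithmic derivative $f^{-1}.df$. Let $E_\eta=\mathbb C\oplus C^\infty(\Sigma,\mathfrak g)$ be the central extension of $C^\infty(\Sigma,\mathfrak g)$ by $\mathbb C$ given by the cocycle $\Omega_\eta(X,Y)=\int_\Sigma\eta\wedge\langle X,dY\rangle$, on which $C^\infty(\Sigma,G)$ operates by $$f.(x,X)=\Big(x-\int_\Sigma\eta\wedge\langle f^{-1}.\bar\partial f,X\rangle,\ \mathrm{Ad}(f).X\Big),$$ and let $E^*=\mathbb C\oplus\Omega^{(0,1)}(\Sigma,\mathfrak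 g)$, where $\Omega^{(0,1)}(\Sigma,\mathfrak g)$ is the space of smooth $\mathfrak g$-valued forms of type $(0,1)$. For $f\in C^\infty(\Sigma,G)$, $(\lambda,\xi)\in E^*$ and $(x,X)\in E_\eta$ put $$(\lambda,\xi)*f=(\lambda,\ \lambda f^{-1}.\bar\partial f+\mathrm{Ad}(f)^{-1}.\xi),\qquad ((\lambda,\xi),(x,X))=\lambda x-\int_\Sigma\eta\wedge\langle\xi,X\rangle .$$ 1. The first formula defines a right action of $C^\infty(\Sigma,G)$ on $E^*$: $e*1=e$ and $e*(fh)=(e*f)*h$ for all $e\in E^*$ and $f,h\in C^\infty(\Sigma,G)$. 2. The pairing is $C^\infty(\Sigma,G)$-invariant: $(e*f,v)=(e,f.v)$ for all $e\in E^*$, $v\in E_\eta$ and $f\in C^\infty(\Sigma,G)$. 3. If $\eta\neq0$, the pairing is non-degenerate: if $(e,v)=0$ for all $v\in E_\eta$ then $e=0$, and if $(e,v)=0$ for all $e\in E^*$ then $v=0$. -/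

import Mathlib

open scoped Manifold ContDiff

noncomputable section

namespace CurrentAlgebra

/-! ### Complex manifolds and complex Lie groups as real smooth ones -/

section Realification

theorem contMDiff_real_of_complex {E : Type*} [NormedAddCommGroup E] [NormedSpace ℂ E]
    {F : Type*} [NormedAddCommGroup F] [NormedSpace ℂ F]
    {M : Type*} [TopologicalSpace M] [ChartedSpace E M]
    {N : Type*} [TopologicalSpace N] [ChartedSpace F N] {f : M → N}
    (hf : ContMDiff 𝓘(ℂ, E) 𝓘(ℂ, F) ω f) : ContMDiff 𝓘(ℝ, E) 𝓘(ℝ, F) ∞ f := by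
  intro x
  have h := hf x
  rw [contMDiffAt_iff] at h ⊢
  exact ⟨h.1, (h.2.restrict_scalars ℝ).of_le le_top⟩

instance isManifold_real {E : Type*} [NormedAddCommGroup E] [NormedSpace ℂ E]
    {M : Type*} [TopologicalSpace M] [ChartedSpace E M] [IsManifold 𝓘(ℂ, E) ω M] :
    IsManifold 𝓘(ℝ, E) ∞ M := by
  refine isManifold_of_contDiffOn _ _ _ fun e e' he he' => ?_
  have h := (contDiffGroupoid ω 𝓘(ℂ, E)).compatible he he'
  rw [contDiffGroupoid, mem_groupoid_of_pregroupoid] at h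
  exact (h.1.restrict_scalars ℝ).of_le le_top

instance lieGroup_real {E : Type*} [NormedAddCommGroup E] [NormedSpace ℂ E]
    {G : Type*} [TopologicalSpace G] [ChartedSpace E G] [Group G] [LieGroup 𝓘(ℂ, E) ω G] :
    LieGroup 𝓘(ℝ, E) ∞ G where
  contMDiff_mul := by
    intro x
    have h := contMDiff_mul 𝓘(ℂ, E) ω (G := G) x
    rw [contMDiffAt_iff] at h ⊢
    exact ⟨h.1, (h.2.restrict_scalars ℝ).of_le le_top⟩
  contMDiff_inv := contMDiff_real_of_complex (contMDiff_inv 𝓘(ℂ, E) ω)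

end Realification

/-! ### The Lie algebra of a complex Lie group and the adjoint representation -/

section LieAlgebra

/-- The Lie algebra `𝔤 = T₁G` of a complex Lie group `G` modelled on `E`. It is Mathlib's
`GroupLieAlgebra`, as a type that carries the norm of the model space `E`, so that smoothness of
`𝔤`-valued maps makes sense. -/
def LieAlg (E : Type*) [NormedAddCommGroup E] [NormedSpace ℂ E]
    (G : Type*) [TopologicalSpace G] [ChartedSpace E G] [Group G] : Type _ :=
  GroupLieAlgebra 𝓘(ℂ, E) G

variable {E : Type*} [NormedAddCommGroup E] [NormedSpace ℂ E]
  {G : Type*} [TopologicalSpace G] [ChartedSpace E G] [Group G]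

instance : NormedAddCommGroup (LieAlg E G) := inferInstanceAs (NormedAddCommGroup E)

instance : NormedSpace ℂ (LieAlg E G) := inferInstanceAs (NormedSpace ℂ E)

instance [FiniteDimensional ℂ E] : FiniteDimensional ℂ (LieAlg E G) :=
  inferInstanceAs (FiniteDimensional ℂ E)

/-- The identity map of `T₁G`. -/
def toGroupLieAlgebra : LieAlg E G ≃ₗ[ℂ] GroupLieAlgebra 𝓘(ℂ, E) G where
  toFun v := v
  invFun v := v
  map_add' _ _ := rfl
  map_smul' _ _ := rfl

/-- The Lie bracket on `𝔤` is that of `GroupLieAlgebra`, the bracket of left invariant vector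
fields. -/
instance [FiniteDimensional ℂ E] [LieGroup 𝓘(ℂ, E) ω G] : LieRing (LieAlg E G) :=
  haveI : CompleteSpace E := FiniteDimensional.complete ℂ E
  { bracket := fun x y => toGroupLieAlgebra.symm ⁅toGroupLieAlgebra x, toGroupLieAlgebra y⁆
    add_lie := fun x y z => by simp [add_lie]
    lie_add := fun x y z => by simp [lie_add]
    lie_self := fun x => by simp
    leibniz_lie := fun x y z => by simp }

instance [FiniteDimensional ℂ E] [LieGroup 𝓘(ℂ, E) ω G] : LieAlgebra ℂ (LieAlg E G) :=
  haveI : CompleteSpace E := FiniteDimensional.complete ℂ E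
  { lie_smul := fun c x y => by
      change toGroupLieAlgebra.symm ⁅toGroupLieAlgebra x, toGroupLieAlgebra (c • y)⁆
        = c • toGroupLieAlgebra.symm ⁅toGroupLieAlgebra x, toGroupLieAlgebra y⁆
      simp }

/-- The adjoint representation: `Ad g` is the derivative at `1` of `h ↦ g h g⁻¹`. -/
def Ad (g : G) : LieAlg E G →L[ℂ] LieAlg E G :=
  mfderiv 𝓘(ℂ, E) 𝓘(ℂ, E) (fun h : G => g * h * g⁻¹) 1

/-- `Ad g` as a real linear map. -/
def AdReal (g : G) : LieAlg E G →L[ℝ] LieAlg E G := (Ad g).restrictScalars ℝ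

variable [LieGroup 𝓘(ℂ, E) ω G]

theorem coordChange_one {𝕜 : Type*} [NontriviallyNormedField 𝕜] {E : Type*}
    [NormedAddCommGroup E] [NormedSpace 𝕜 E] {G : Type*} [TopologicalSpace G] [ChartedSpace E G]
    [Group G] [IsManifold 𝓘(𝕜, E) 1 G] (a b : G) (ha : a = 1) (hb : b = 1) :
    (tangentBundleCore 𝓘(𝕜, E) G).coordChange (achart E a) (achart E b) a
      = ContinuousLinearMap.id 𝕜 E := by
  subst ha
  subst hb
  exact ContinuousLinearMap.ext
    ((tangentBundleCore 𝓘(𝕜, E) G).coordChange_self (achart E 1) 1 (mem_chart_source E _))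

variable (E G) in
theorem contMDiff_Ad :
    ContMDiff 𝓘(ℂ, E) 𝓘(ℂ, LieAlg E G →L[ℂ] LieAlg E G) ω (Ad (E := E) (G := G)) := by
  intro g₀
  have h0 : ContMDiffAt (𝓘(ℂ, E).prod 𝓘(ℂ, E)) 𝓘(ℂ, E) ω
      (Function.uncurry fun g h : G => g * h * g⁻¹) (g₀, 1) :=
    ((contMDiff_fst.mul contMDiff_snd).mul contMDiff_fst.inv).contMDiffAt
  have h := ContMDiffAt.mfderiv (m := ω) (fun g h : G => g * h * g⁻¹) (fun _ => 1) h0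
    contMDiffAt_const (by simp)
  refine h.congr_of_eventuallyEq (.of_forall fun g => ?_)
  refine Eq.trans ?_ (inTangentCoordinates_eq (E := E) (E' := E) (fun _ => (1 : G))
    (fun x => x * 1 * x⁻¹) (fun x => mfderiv 𝓘(ℂ, E) 𝓘(ℂ, E) (fun h : G => x * h * x⁻¹) 1) (by simp) (by simp)).symm
  have h3 := coordChange_one (𝕜 := ℂ) (E := E) (g * 1 * g⁻¹) (g₀ * 1 * g₀⁻¹) (by simp) (by simp)
  have h4 := coordChange_one (𝕜 := ℂ) (E := E) (1 : G) 1 rfl rfl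
  have h5 : ∀ A : E →L[ℂ] E, A = (ContinuousLinearMap.id ℂ E).comp
      (A.comp (ContinuousLinearMap.id ℂ E)) := fun A => rfl
  refine (h5 (Ad (E := E) g)).trans ?_
  exact congrArg₂ (fun (T : E →L[ℂ] E) (D : E →L[ℂ] E) =>
    T.comp (ContinuousLinearMap.comp (Ad (E := E) g) D)) h3.symm h4.symm

theorem contMDiff_AdReal {S : Type*} [TopologicalSpace S] [ChartedSpace ℂ S] {f : S → G}
    (hf : ContMDiff 𝓘(ℝ, ℂ) 𝓘(ℝ, E) ∞ f) :
    ContMDiff 𝓘(ℝ, ℂ) 𝓘(ℝ, LieAlg E G →L[ℝ] LieAlg E G) ∞ fun m => AdReal (E := E) (f m) :=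
  ((ContinuousLinearMap.restrictScalarsL ℂ (LieAlg E G) (LieAlg E G) ℝ ℝ).contMDiff.comp
    (contMDiff_real_of_complex (contMDiff_Ad E G))).comp hf

end LieAlgebra

/-! ### Differential forms of degree one on a Riemann surface -/

section Forms

/-- Not necessarily continuous 1-forms on the surface `S` with values in `V`: a real linear map on
every real tangent space. -/
abbrev OneForm (S : Type*) [TopologicalSpace S] [ChartedSpace ℂ S]
    (V : Type*) [NormedAddCommGroup V] [NormedSpace ℂ V] :=
  ∀ m : S, TangentSpace 𝓘(ℝ, ℂ) m →L[ℝ] V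

variable {S : Type*} [TopologicalSpace S] [ChartedSpace ℂ S]
  {V : Type*} [NormedAddCommGroup V] [NormedSpace ℂ V]

/-- Multiplication by `i` on the real tangent space `T_m S`. Mathlib's tangent space at `m` is the
model space `ℂ`, through the preferred chart at `m`, and changes of charts are holomorphic, so
that this is the multiplication by `i` in any holomorphic chart. -/
def complexStructure (m : S) : TangentSpace 𝓘(ℝ, ℂ) m →L[ℝ] TangentSpace 𝓘(ℝ, ℂ) m :=
  show ℂ →L[ℝ] ℂ from ContinuousLinearMap.mul ℝ ℂ Complex.I

theorem complexStructure_sq (m : S) (v : TangentSpace 𝓘(ℝ, ℂ) m) :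
    complexStructure m (complexStructure m v) = -v := by
  have h : ∀ w : ℂ, Complex.I * (Complex.I * w) = -w := fun w => by
    rw [← mul_assoc, Complex.I_mul_I, neg_one_mul]
  exact h v

/-- The `(0,1)`-part `v ↦ (α(v) + i α(iv)) / 2` of a 1-form `α`. -/
def antiPart (α : OneForm S V) : OneForm S V := fun m =>
  (1 / 2 : ℂ) • (α m + Complex.I • (α m).comp (complexStructure m))

/-- The value at `m` of a 1-form, read in the preferred chart at `m`. -/
def inModel (α : OneForm S V) (m : S) : ℂ →L[ℝ] V := α m

/-- The left logarithmic derivative `f⁻¹.df` of a map `f` from the surface to the group: at the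
point `m` it is the differential `df_m : T_m S → T_{f m} G` followed by the derivative
`T_{f m} G → T_1 G` of the left translation by `(f m)⁻¹`. -/
def leftLogDeriv {E : Type*} [NormedAddCommGroup E] [NormedSpace ℂ E]
    {G : Type*} [TopologicalSpace G] [ChartedSpace E G] [Group G] (f : S → G) :
    OneForm S (LieAlg E G) := fun m =>
  (mfderiv 𝓘(ℝ, E) 𝓘(ℝ, E) (fun h : G => (f m)⁻¹ * h) (f m)).comp (mfderiv 𝓘(ℝ, ℂ) 𝓘(ℝ, E) f m)

variable [IsManifold 𝓘(ℂ) ω S]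

/-- A 1-form is smooth if it is a smooth section of the (real) bundle of linear maps from the
tangent bundle to the trivial bundle with fibre `V`. -/
def IsSmoothOneForm (α : OneForm S V) : Prop :=
  ContMDiff 𝓘(ℝ, ℂ) (𝓘(ℝ, ℂ).prod 𝓘(ℝ, ℂ →L[ℝ] V)) ∞
    (fun m : S => Bundle.TotalSpace.mk' (ℂ →L[ℝ] V)
      (E := fun m : S => TangentSpace 𝓘(ℝ, ℂ) m →L[ℝ] Bundle.Trivial S V m) m (α m))

/-- A holomorphic 1-form: complex linear on each tangent space, and a holomorphic section of the
(complex) bundle of linear maps from the tangent bundle to the trivial bundle with fibre `ℂ`. -/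
def IsHolomorphicOneForm (η : ∀ m : S, TangentSpace 𝓘(ℂ) m →L[ℂ] ℂ) : Prop :=
  ContMDiff 𝓘(ℂ) (𝓘(ℂ).prod 𝓘(ℂ, ℂ →L[ℂ] ℂ)) ω
    (fun m : S => Bundle.TotalSpace.mk' (ℂ →L[ℂ] ℂ)
      (E := fun m : S => TangentSpace 𝓘(ℂ) m →L[ℂ] Bundle.Trivial S ℂ m) m (η m))

theorem isSmoothOneForm_iff (α : OneForm S V) : IsSmoothOneForm α ↔ ∀ m₀ : S,
    ContMDiffAt 𝓘(ℝ, ℂ) 𝓘(ℝ, ℂ →L[ℝ] V) ∞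
      (fun m : S => (inModel α m).comp (tangentCoordChange 𝓘(ℝ, ℂ) m₀ m m)) m₀ := by
  refine forall_congr' fun m₀ => ?_
  rw [contMDiffAt_hom_bundle]
  have key : (fun m : S => ContinuousLinearMap.inCoordinates ℂ (TangentSpace 𝓘(ℝ, ℂ) (M := S)) V
      (Bundle.Trivial S V) m₀ m m₀ m (α m)) =ᶠ[nhds m₀]
      fun m : S => (inModel α m).comp (tangentCoordChange 𝓘(ℝ, ℂ) m₀ m m) := by
    filter_upwards [(chartAt ℂ m₀).open_source.mem_nhds (mem_chart_source ℂ m₀)] with m hm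
    have h1 := TangentBundle.symmL_trivializationAt_eq_core (I := 𝓘(ℝ, ℂ)) hm
    have h2 := Bundle.Trivial.continuousLinearMapAt_trivialization (𝕜 := ℝ) (B := S) (F := V) m
    exact (congrArg (fun T : V →L[ℝ] V => T.comp ((inModel α m).comp
        ((trivializationAt ℂ (TangentSpace 𝓘(ℝ, ℂ) (M := S)) m₀).symmL ℝ m))) h2).trans
      (congrArg (fun T : ℂ →L[ℝ] ℂ => (inModel α m).comp T) h1)
  exact ⟨fun h => h.2.congr_of_eventuallyEq key.symm,
    fun h => ⟨contMDiffAt_id, h.congr_of_eventuallyEq key⟩⟩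

theorem tangentCoordChange_I {m₀ m : S} (hm : m ∈ (chartAt ℂ m₀).source) (v : ℂ) :
    tangentCoordChange 𝓘(ℝ, ℂ) m₀ m m (Complex.I * v)
      = Complex.I * tangentCoordChange 𝓘(ℝ, ℂ) m₀ m m v := by
  have h : HasFDerivWithinAt (extChartAt 𝓘(ℂ) m ∘ (extChartAt 𝓘(ℂ) m₀).symm)
      (tangentCoordChange 𝓘(ℂ) m₀ m m) (Set.range 𝓘(ℂ)) (extChartAt 𝓘(ℂ) m₀ m) :=
    hasFDerivWithinAt_tangentCoordChange (by simp [hm])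
  have h' := (h.restrictScalars ℝ).fderivWithin (by simp)
  have h2 : tangentCoordChange 𝓘(ℝ, ℂ) m₀ m m
      = (tangentCoordChange 𝓘(ℂ) m₀ m m).restrictScalars ℝ := h'
  rw [h2]
  exact (tangentCoordChange 𝓘(ℂ) m₀ m m).map_smul Complex.I v

theorem isSmoothOneForm_zero : IsSmoothOneForm (0 : OneForm S V) := by
  refine (isSmoothOneForm_iff _).2 fun m₀ => ?_
  exact (contMDiffAt_const (c := (0 : ℂ →L[ℝ] V))).congr_of_eventuallyEq (.of_forall fun m => rfl)

theorem IsSmoothOneForm.add {α β : OneForm S V} (hα : IsSmoothOneForm α)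
    (hβ : IsSmoothOneForm β) : IsSmoothOneForm (α + β) :=
  (isSmoothOneForm_iff _).2 fun m₀ =>
    ((isSmoothOneForm_iff α).1 hα m₀).add ((isSmoothOneForm_iff β).1 hβ m₀)

theorem IsSmoothOneForm.clm_comp {A : S → V →L[ℝ] V}
    (hA : ContMDiff 𝓘(ℝ, ℂ) 𝓘(ℝ, V →L[ℝ] V) ∞ A) {α : OneForm S V} (hα : IsSmoothOneForm α) :
    IsSmoothOneForm fun m => (A m).comp (α m) :=
  (isSmoothOneForm_iff _).2 fun m₀ => (hA m₀).clm_comp ((isSmoothOneForm_iff α).1 hα m₀)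

theorem IsSmoothOneForm.const_smul (c : ℂ) {α : OneForm S V} (hα : IsSmoothOneForm α) :
    IsSmoothOneForm (c • α) :=
  hα.clm_comp (A := fun _ => (c • ContinuousLinearMap.id ℂ V).restrictScalars ℝ) contMDiff_const

theorem IsSmoothOneForm.comp_complexStructure {α : OneForm S V} (hα : IsSmoothOneForm α) :
    IsSmoothOneForm fun m => (α m).comp (complexStructure m) := by
  refine (isSmoothOneForm_iff _).2 fun m₀ => ?_
  have h := ((isSmoothOneForm_iff α).1 hα m₀).clm_comp
    (contMDiffAt_const (c := ContinuousLinearMap.mul ℝ ℂ Complex.I))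
  refine h.congr_of_eventuallyEq ?_
  filter_upwards [(chartAt ℂ m₀).open_source.mem_nhds (mem_chart_source ℂ m₀)] with m hm
  refine ContinuousLinearMap.ext fun v => ?_
  exact congrArg (inModel α m) (tangentCoordChange_I hm v).symm

theorem IsSmoothOneForm.antiPart {α : OneForm S V} (hα : IsSmoothOneForm α) :
    IsSmoothOneForm (antiPart α) :=
  (hα.add (hα.comp_complexStructure.const_smul Complex.I)).const_smul (1 / 2)

theorem isSmoothOneForm_leftLogDeriv {E : Type*} [NormedAddCommGroup E] [NormedSpace ℂ E]
    {G : Type*} [TopologicalSpace G] [ChartedSpace E G] [Group G] [LieGroup 𝓘(ℂ, E) ω G]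
    {f : S → G} (hf : ContMDiff 𝓘(ℝ, ℂ) 𝓘(ℝ, E) ∞ f) :
    IsSmoothOneForm (leftLogDeriv (E := E) f) := by
  refine (isSmoothOneForm_iff _).2 fun m₀ => ?_
  have h0 : ContMDiffAt (𝓘(ℝ, ℂ).prod 𝓘(ℝ, ℂ)) 𝓘(ℝ, E) ∞
      (Function.uncurry fun x y : S => (f x)⁻¹ * f y) (m₀, id m₀) :=
    ((hf.comp contMDiff_fst).inv.mul (hf.comp contMDiff_snd)).contMDiffAt
  have h := ContMDiffAt.mfderiv (m := ∞) (fun x y : S => (f x)⁻¹ * f y) id h0 contMDiffAt_id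
    (by simp)
  refine h.congr_of_eventuallyEq ?_
  filter_upwards [(chartAt ℂ m₀).open_source.mem_nhds (mem_chart_source ℂ m₀)] with m hm
  refine Eq.trans ?_ (inTangentCoordinates_eq id (fun x => (f x)⁻¹ * f (id x))
    (fun x => mfderiv 𝓘(ℝ, ℂ) 𝓘(ℝ, E) (fun y => (f x)⁻¹ * f y) (id x)) hm (by simp)).symm
  have h1 : mfderiv 𝓘(ℝ, ℂ) 𝓘(ℝ, E) (fun y => (f m)⁻¹ * f y) m =
      (mfderiv 𝓘(ℝ, E) 𝓘(ℝ, E) (fun h : G => (f m)⁻¹ * h) (f m)).comp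
        (mfderiv 𝓘(ℝ, ℂ) 𝓘(ℝ, E) f m) :=
    mfderiv_comp (I' := 𝓘(ℝ, E)) m (g := fun h : G => (f m)⁻¹ * h)
      ((contMDiff_mul_left (n := ∞)).mdifferentiable (by simp) _)
      (hf.mdifferentiable (by simp) _)
  have h3 := coordChange_one (𝕜 := ℝ) (E := E) ((f m)⁻¹ * f m) ((f m₀)⁻¹ * f m₀)
    (by simp) (by simp)
  have h5 : ∀ A : ℂ →L[ℝ] E, A = (ContinuousLinearMap.id ℝ E).comp A := fun A => rfl
  refine (h5 _).trans ?_
  exact congrArg₂ (fun (T : E →L[ℝ] E) (D : ℂ →L[ℝ] E) =>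
    T.comp (D.comp (tangentCoordChange 𝓘(ℝ, ℂ) m₀ m m))) h3.symm h1.symm

variable (S V) in
/-- `Ω^{(0,1)}(S, V)`: the smooth 1-forms `ξ` with `ξ(iv) = -i ξ(v)`. -/
def Omega01 : Submodule ℂ (OneForm S V) where
  carrier := {ξ | IsSmoothOneForm ξ ∧
    ∀ (m : S) (v : TangentSpace 𝓘(ℝ, ℂ) m), ξ m (complexStructure m v) = -(Complex.I • ξ m v)}
  zero_mem' := ⟨isSmoothOneForm_zero, fun m v => by simp⟩
  add_mem' {α β} hα hβ := ⟨hα.1.add hβ.1, fun m v => by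
    simp only [Pi.add_apply, add_apply, hα.2, hβ.2, smul_add, neg_add]⟩
  smul_mem' c α hα := ⟨hα.1.const_smul c, fun m v => by
    simp only [Pi.smul_apply, smul_apply, hα.2, smul_neg]
    rw [smul_comm]⟩

theorem antiPart_mem_Omega01 {α : OneForm S V} (hα : IsSmoothOneForm α) :
    antiPart α ∈ Omega01 S V := by
  refine ⟨hα.antiPart, fun m v => ?_⟩
  simp only [antiPart, smul_apply, add_apply,
    ContinuousLinearMap.comp_apply, complexStructure_sq, map_neg]
  rw [smul_comm Complex.I, ← smul_neg]
  congr 1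
  rw [smul_add, smul_smul, Complex.I_mul_I]
  simp only [neg_smul, one_smul, smul_neg]
  abel

end Forms

/-! ### Forms of degree two and their integral -/

section Integral

/-- Not necessarily continuous complex valued 2-forms on the surface `S`. -/
abbrev TwoForm (S : Type*) [TopologicalSpace S] [ChartedSpace ℂ S] :=
  ∀ m : S, (TangentSpace 𝓘(ℝ, ℂ) m) [⋀^Fin 2]→ₗ[ℝ] ℂ

variable {S : Type*} [TopologicalSpace S] [ChartedSpace ℂ S]

/-- The wedge product `(α ∧ β)(v, w) = α(v) β(w) - α(w) β(v)` of two 1-forms. -/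
def wedge (α β : OneForm S ℂ) : TwoForm S := fun m =>
  { toFun := fun v => α m (v 0) * β m (v 1) - α m (v 1) * β m (v 0)
    map_update_add' := by
      intro _ v i x y
      fin_cases i <;> simp [Function.update] <;> ring
    map_update_smul' := by
      intro _ v i c x
      fin_cases i <;> simp [Function.update] <;> ring
    map_eq_zero_of_eq' := by
      intro v i j hij hne
      fin_cases i <;> fin_cases j <;> simp_all }

variable [IsManifold 𝓘(ℂ) ω S] [CompactSpace S] [T2Space S]

variable (S) in
/-- A smooth partition of unity on the surface, subordinate to the preferred holomorphic charts. -/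
def chartPartition : SmoothPartitionOfUnity S 𝓘(ℝ, ℂ) S Set.univ :=
  (SmoothPartitionOfUnity.exists_isSubordinate_chartAt_source 𝓘(ℝ, ℂ) S).choose

theorem chartPartition_isSubordinate :
    (chartPartition S).IsSubordinate fun p => (chartAt ℂ p).source :=
  (SmoothPartitionOfUnity.exists_isSubordinate_chartAt_source 𝓘(ℝ, ℂ) S).choose_spec

/-- The integral of a 2-form over the compact surface, oriented by its complex structure. With a
partition of unity `ρ` subordinate to the charts, it is the sum of the integrals of `ρ_p τ` in the
chart at `p`, where `τ = τ(∂/∂x, ∂/∂y) dx ∧ dy` in the coordinate `z = x + iy`. -/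
def surfaceIntegral (τ : TwoForm S) : ℂ :=
  ∑ᶠ p : S, ∫ z in (chartAt ℂ p).target,
    (chartPartition S p ((chartAt ℂ p).symm z) : ℂ) *
      τ ((chartAt ℂ p).symm z)
        ![mfderiv 𝓘(ℝ, ℂ) 𝓘(ℝ, ℂ) (chartAt ℂ p).symm z (1 : ℂ),
          mfderiv 𝓘(ℝ, ℂ) 𝓘(ℝ, ℂ) (chartAt ℂ p).symm z Complex.I]

end Integral

/-! ### The central extension, the smooth dual, the actions and the pairing -/

section Pairing

/-- The group `C^∞(S, G)` with pointwise multiplication. -/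
abbrev CurrentGroup (S : Type*) [TopologicalSpace S] [ChartedSpace ℂ S]
    (E : Type*) [NormedAddCommGroup E] [NormedSpace ℂ E]
    (G : Type*) [TopologicalSpace G] [ChartedSpace E G] :=
  ContMDiffMap 𝓘(ℝ, ℂ) 𝓘(ℝ, E) S G ∞

/-- The space `C^∞(S, 𝔤)`. -/
abbrev CurrentAlg (S : Type*) [TopologicalSpace S] [ChartedSpace ℂ S]
    (E : Type*) [NormedAddCommGroup E] [NormedSpace ℂ E]
    (G : Type*) [TopologicalSpace G] [ChartedSpace E G] [Group G] :=
  ContMDiffMap 𝓘(ℝ, ℂ) 𝓘(ℝ, LieAlg E G) S (LieAlg E G) ∞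

/-- The space `E^* = ℂ ⊕ Ω^{(0,1)}(S, 𝔤)`. -/
abbrev DualSpace (S : Type*) [TopologicalSpace S] [ChartedSpace ℂ S] [IsManifold 𝓘(ℂ) ω S]
    (E : Type*) [NormedAddCommGroup E] [NormedSpace ℂ E]
    (G : Type*) [TopologicalSpace G] [ChartedSpace E G] [Group G] :=
  ℂ × Omega01 S (LieAlg E G)

variable {S : Type*} [TopologicalSpace S] [ChartedSpace ℂ S]
  {E : Type*} [NormedAddCommGroup E] [NormedSpace ℂ E]
  {G : Type*} [TopologicalSpace G] [ChartedSpace E G] [Group G]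

/-- A complex linear 1-form as a complex valued 1-form on the real tangent spaces. -/
def realForm (η : ∀ m : S, TangentSpace 𝓘(ℂ) m →L[ℂ] ℂ) : OneForm S ℂ := fun m =>
  (show ℂ →L[ℂ] ℂ from η m).restrictScalars ℝ

/-- The complex valued 1-form `⟨α, X⟩` for a `𝔤`-valued 1-form `α` and a function `X` with values
in `𝔤`, formed pointwise with the bilinear form `B = ⟨·, ·⟩`. -/
def formPairing [FiniteDimensional ℂ E] (B : LinearMap.BilinForm ℂ (LieAlg E G))
    (α : OneForm S (LieAlg E G)) (X : S → LieAlg E G) : OneForm S ℂ := fun m =>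
  ((LinearMap.toContinuousLinearMap (B.flip (X m))).restrictScalars ℝ).comp (α m)

variable [IsManifold 𝓘(ℂ) ω S]

section Actions

variable [LieGroup 𝓘(ℂ, E) ω G]

/-- The form `f⁻¹.∂̄f`, which is the `(0,1)`-part of the left logarithmic derivative of `f`. -/
def dbarLog (f : CurrentGroup S E G) : Omega01 S (LieAlg E G) :=
  ⟨antiPart (leftLogDeriv f), antiPart_mem_Omega01 (isSmoothOneForm_leftLogDeriv f.contMDiff)⟩

/-- `Ad(f).ξ`, formed pointwise, for `ξ ∈ Ω^{(0,1)}(S, 𝔤)`. -/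
def adForm (f : CurrentGroup S E G) (ξ : Omega01 S (LieAlg E G)) : Omega01 S (LieAlg E G) :=
  ⟨fun m => (AdReal (f m)).comp (ξ.1 m), ξ.2.1.clm_comp (contMDiff_AdReal f.contMDiff),
    fun m v => by
      rw [ContinuousLinearMap.comp_apply, ξ.2.2 m v, map_neg]
      exact congrArg Neg.neg ((Ad (f m)).map_smul Complex.I (ξ.1 m v))⟩

/-- `Ad(f).X`, formed pointwise, for `X ∈ C^∞(S, 𝔤)`. -/
def adMap (f : CurrentGroup S E G) (X : CurrentAlg S E G) : CurrentAlg S E G :=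
  ⟨fun m => AdReal (f m) (X m), (contMDiff_AdReal f.contMDiff).clm_apply X.contMDiff⟩

/-- The operation `(λ, ξ) * f = (λ, λ f⁻¹.∂̄f + Ad(f)⁻¹.ξ)` of `C^∞(S, G)` on `E^*`. -/
def dualAct (e : DualSpace S E G) (f : CurrentGroup S E G) : DualSpace S E G :=
  (e.1, e.1 • dbarLog f + adForm f⁻¹ e.2)

end Actions

variable [CompactSpace S] [T2Space S] [FiniteDimensional ℂ E] [LieGroup 𝓘(ℂ, E) ω G]

/-- The cocycle `Ω_η(X, Y) = ∫ η ∧ ⟨X, dY⟩` on `C^∞(S, 𝔤)`. -/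
def cocycle (η : ∀ m : S, TangentSpace 𝓘(ℂ) m →L[ℂ] ℂ) (B : LinearMap.BilinForm ℂ (LieAlg E G))
    (X Y : CurrentAlg S E G) : ℂ :=
  surfaceIntegral (wedge (realForm η) (formPairing B.flip
    (fun m => mfderiv 𝓘(ℝ, ℂ) 𝓘(ℝ, LieAlg E G) Y m) X))

/-- The space `E_η = ℂ ⊕ C^∞(S, 𝔤)`, the central extension of `C^∞(S, 𝔤)` by `ℂ` that belongs to
the cocycle `Ω_η`. -/
def CentralExtension (_η : ∀ m : S, TangentSpace 𝓘(ℂ) m →L[ℂ] ℂ)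
    (_B : LinearMap.BilinForm ℂ (LieAlg E G)) : Type _ :=
  ℂ × CurrentAlg S E G

instance (η : ∀ m : S, TangentSpace 𝓘(ℂ) m →L[ℂ] ℂ) (B : LinearMap.BilinForm ℂ (LieAlg E G)) :
    AddCommGroup (CentralExtension η B) :=
  inferInstanceAs (AddCommGroup (ℂ × CurrentAlg S E G))

variable {η : ∀ m : S, TangentSpace 𝓘(ℂ) m →L[ℂ] ℂ} {B : LinearMap.BilinForm ℂ (LieAlg E G)}

/-- The pointwise bracket on `C^∞(S, 𝔤)`. -/
def currentBracket (X Y : CurrentAlg S E G) : CurrentAlg S E G :=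
  ⟨fun m => ⁅X m, Y m⁆, by
    let L : LieAlg E G →ₗ[ℝ] LieAlg E G →L[ℝ] LieAlg E G :=
      ((ContinuousLinearMap.restrictScalarsₗ ℂ (LieAlg E G) (LieAlg E G) ℝ ℝ) ∘ₗ
        ((LinearMap.toContinuousLinearMap.toLinearMap ∘ₗ
          (LieModule.toEnd ℂ (LieAlg E G) (LieAlg E G) :
            LieAlg E G →ₗ[ℂ] Module.End ℂ (LieAlg E G))).restrictScalars ℝ))
    have : FiniteDimensional ℝ (LieAlg E G) := FiniteDimensional.trans ℝ ℂ (LieAlg E G)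
    exact ((LinearMap.toContinuousLinearMap L).contMDiff.comp X.contMDiff).clm_apply Y.contMDiff⟩

/-- The bracket `[(x, X), (y, Y)] = (Ω_η(X, Y), [X, Y])` of the central extension. -/
instance : Bracket (CentralExtension η B) (CentralExtension η B) where
  bracket u v := (cocycle η B u.2 v.2, currentBracket u.2 v.2)

/-- The operation `f.(x, X) = (x - ∫ η ∧ ⟨f⁻¹.∂̄f, X⟩, Ad(f).X)` of `C^∞(S, G)` on `E_η`. -/
def extAct (f : CurrentGroup S E G) (v : CentralExtension η B) : CentralExtension η B :=
  (v.1 - surfaceIntegral (wedge (realForm η) (formPairing B (dbarLog f).1 v.2)), adMap f v.2)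

/-- The pairing `((λ, ξ), (x, X)) = λ x - ∫ η ∧ ⟨ξ, X⟩` between `E^*` and `E_η`. -/
def pairing (e : DualSpace S E G) (v : CentralExtension η B) : ℂ :=
  e.1 * v.1 - surfaceIntegral (wedge (realForm η) (formPairing B e.2.1 v.2))

end Pairing

end CurrentAlgebra

end

open CurrentAlgebra

/-!
The action on `E^*` is a right action because the left logarithmic derivative obeys the product
rule `(f h)⁻¹.d(f h) = h⁻¹.dh + Ad(h)⁻¹.(f⁻¹.df)` (`leftLogDeriv_mul`), which in turn comes down to
the fact that the derivative of the multiplication at `(1, 1)` is the addition, and because `Ad` is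
a homomorphism.

The invariance of the pairing reduces pointwise to `⟨Ad(g)⁻¹ x, y⟩ = ⟨x, Ad(g) y⟩`
(`apply_Ad_inv`). Since `G` need not be connected, this does not follow from the invariance of the
form under `𝔤` by integration. By Schur's lemma and Cartan's criterion, however, the form is a
multiple of the Killing form (`exists_eq_smul_killingForm`), which is invariant under all
automorphisms of `𝔤`, and `Ad(g)` is an automorphism (`Ad_lie`): conjugation by `g` pulls left
invariant vector fields back to left invariant ones. The additivity of the integral rests on the
continuity of the forms involved.

For the non-degeneracy, the wedge product of a form `α` of type `(1,0)` and a form `β` of type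
`(0,1)` is `-2i α(1) β(1)` times a positive density (`chartCoeff_wedge`), so that
`∫ α ∧ β = 0` forces `α(1) β(1) = 0` whenever this function is non-negative
(`eq_zero_of_surfaceIntegral_wedge`). Given `ξ` or `X`, a partner that makes the integrand of
`∫ η ∧ ⟨ξ, X⟩` non-negative arises by complex conjugation: locally `X = ρ ḡ y`, where `ρ` is a
partition function and `g` the coefficient of `η ∧ ⟨ξ, y⟩`, and globally `ξ = η̄ ⊗ Y` with `Y` the
sum over a basis of the `conj ⟨bᵢ, X⟩ bᵢ`. So `ξ` or `X` vanishes where `η` does not, which is a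
dense set by the identity theorem (`IsHolomorphicOneForm.dense_ne_zero`).
-/

noncomputable section

namespace CurrentAlgebra

/-! ### Invariant forms on a simple Lie algebra -/

section InvariantForm

variable {L : Type*} [LieRing L] [LieAlgebra ℂ L] [FiniteDimensional ℂ L]

/-- The left kernel of an invariant bilinear form is an ideal. -/
def leftKernel (Φ : LinearMap.BilinForm ℂ L) (hΦ : Φ.lieInvariant L) : LieIdeal ℂ L where
  __ := LinearMap.ker Φ
  lie_mem {x y} hy := by
    have hy' : Φ y = 0 := hy
    change Φ ⁅x, y⁆ = 0
    ext z
    rw [hΦ, hy']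
    simp

omit [FiniteDimensional ℂ L] in
theorem mem_leftKernel {Φ : LinearMap.BilinForm ℂ L} {hΦ : Φ.lieInvariant L} {x : L} :
    x ∈ leftKernel Φ hΦ ↔ Φ x = 0 := Iff.rfl

omit [FiniteDimensional ℂ L] in
theorem lieInvariant_killingForm : (killingForm ℂ L).lieInvariant L := fun x y z => by
  rw [← lie_skew, map_neg, LinearMap.neg_apply]
  exact congrArg Neg.neg (LieModule.traceForm_apply_lie_apply ℂ L L y x z)

/-- Schur's lemma for invariant forms: a non-degenerate invariant form on a simple complex Lie
algebra is a multiple of the Killing form. The map `T` with `κ(x, y) = B(T x, y)` has an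
eigenvalue `c`, and the corresponding eigenspace is the left kernel of `κ - c B`, an ideal. The
Killing form does not vanish by Cartan's criterion. -/
theorem exists_eq_smul_killingForm [LieAlgebra.IsSimple ℂ L] {B : LinearMap.BilinForm ℂ L}
    (hB : B.Nondegenerate) (hB_inv : B.lieInvariant L) :
    ∃ c : ℂ, B = c • killingForm ℂ L := by
  have : Nontrivial L := by
    by_contra h
    rw [not_nontrivial_iff_subsingleton] at h
    exact LieAlgebra.IsSimple.non_abelian (R := ℂ) (L := L) ⟨fun _ _ => Subsingleton.elim _ _⟩
  let e : L ≃ₗ[ℂ] Module.Dual ℂ L := LinearMap.linearEquivOfInjective B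
    (LinearMap.ker_eq_bot.1 (LinearMap.separatingLeft_iff_ker_eq_bot.1 hB.1))
    Subspace.dual_finrank_eq.symm
  have he : ∀ x, e x = B x := fun x => rfl
  obtain ⟨c, hc⟩ := Module.End.exists_eigenvalue (e.symm.toLinearMap ∘ₗ killingForm ℂ L)
  obtain ⟨v, hv, hv0⟩ := hc.exists_hasEigenvector
  have hv1 : killingForm ℂ L v = c • B v := by
    have h := congrArg e (Module.End.mem_eigenspace_iff.1 hv)
    rw [map_smul, he] at h
    exact (e.apply_symm_apply _).symm.trans h
  have hinv : (killingForm ℂ L - c • B).lieInvariant L := fun x y z => by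
    have h1 := lieInvariant_killingForm (L := L) x y z
    have h2 := hB_inv x y z
    simp only [LinearMap.sub_apply, LinearMap.smul_apply, h1, h2, smul_eq_mul]
    ring
  have htop : leftKernel _ hinv = ⊤ := by
    refine (LieAlgebra.IsSimple.eq_bot_or_eq_top _).resolve_left fun h => hv0 ?_
    have : v ∈ leftKernel _ hinv := by
      rw [mem_leftKernel, LinearMap.sub_apply, hv1, LinearMap.smul_apply, sub_self]
    rw [h] at this
    exact (LieSubmodule.mem_bot v).1 this
  have hκ : killingForm ℂ L = c • B := by
    refine LinearMap.ext fun x => ?_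
    have : x ∈ leftKernel _ hinv := htop ▸ LieSubmodule.mem_top x
    exact sub_eq_zero.1 (mem_leftKernel.1 this)
  have hc0 : c ≠ 0 := by
    rintro rfl
    obtain ⟨w, hw⟩ := exists_ne (0 : L)
    refine hw ((LieAlgebra.IsKilling.killingForm_nondegenerate ℂ L).1 w fun y => ?_)
    rw [hκ]
    simp
  exact ⟨c⁻¹, by rw [hκ, smul_smul, inv_mul_cancel₀ hc0, one_smul]⟩

theorem apply_equiv_apply_equiv [LieAlgebra.IsSimple ℂ L] {B : LinearMap.BilinForm ℂ L}
    (hB : B.Nondegenerate) (hB_inv : B.lieInvariant L) (e : L ≃ₗ⁅ℂ⁆ L) (x y : L) :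
    B (e x) (e y) = B x y := by
  obtain ⟨c, rfl⟩ := exists_eq_smul_killingForm hB hB_inv
  simp only [LinearMap.smul_apply, LieAlgebra.killingForm_of_equiv_apply]

end InvariantForm

/-! ### The adjoint representation -/

section AdjointRepresentation

open VectorField

variable {E : Type*} [NormedAddCommGroup E] [NormedSpace ℂ E]
  {G : Type*} [TopologicalSpace G] [ChartedSpace E G] [Group G] [LieGroup 𝓘(ℂ, E) ω G]

variable (E) in
theorem mdifferentiableAt_conj (g h : G) :
    MDifferentiableAt 𝓘(ℂ, E) 𝓘(ℂ, E) (fun x : G => g * x * g⁻¹) h :=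
  ((((contMDiff_const (c := g)).mul contMDiff_id).mul contMDiff_const :
    ContMDiff 𝓘(ℂ, E) 𝓘(ℂ, E) ω (fun x : G => g * x * g⁻¹)).mdifferentiable (by simp)) h

omit [LieGroup 𝓘(ℂ, E) ω G] in
theorem Ad_one : Ad (E := E) (1 : G) = ContinuousLinearMap.id ℂ (LieAlg E G) := by
  have h : (fun x : G => 1 * x * 1⁻¹) = id := by ext x; simp
  unfold Ad
  rw [h, mfderiv_id]
  rfl

/-- The derivative of a map at a point that equals `1` is its derivative at `1`. The tangent
spaces at both points are the model space. -/
theorem mfderiv_of_eq_one {𝕜 : Type*} [NontriviallyNormedField 𝕜] {E : Type*}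
    [NormedAddCommGroup E] [NormedSpace 𝕜 E] {G : Type*} [TopologicalSpace G] [ChartedSpace E G]
    [Group G] (F : G → G) {a : G} (ha : a = 1) :
    (mfderiv 𝓘(𝕜, E) 𝓘(𝕜, E) F a : E →L[𝕜] E) = (mfderiv 𝓘(𝕜, E) 𝓘(𝕜, E) F 1 : E →L[𝕜] E) := by
  subst ha
  rfl

theorem Ad_mul_apply (g h : G) (x : LieAlg E G) : Ad (g * h) x = Ad g (Ad h x) := by
  have h1 : (fun x : G => g * h * x * (g * h)⁻¹)
      = (fun x : G => g * x * g⁻¹) ∘ fun x : G => h * x * h⁻¹ := by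
    ext x
    simp [mul_assoc]
  have h2 : (mfderiv 𝓘(ℂ, E) 𝓘(ℂ, E) (fun x : G => g * h * x * (g * h)⁻¹) 1 : E →L[ℂ] E)
      = (mfderiv 𝓘(ℂ, E) 𝓘(ℂ, E) (fun x : G => g * x * g⁻¹) (h * 1 * h⁻¹) : E →L[ℂ] E).comp
        (mfderiv 𝓘(ℂ, E) 𝓘(ℂ, E) (fun x : G => h * x * h⁻¹) 1 : E →L[ℂ] E) := by
    rw [h1]
    exact mfderiv_comp (I' := 𝓘(ℂ, E)) 1 (mdifferentiableAt_conj E g _)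
      (mdifferentiableAt_conj E h _)
  rw [mfderiv_of_eq_one _ (by simp : h * 1 * h⁻¹ = 1)] at h2
  exact DFunLike.congr_fun h2 x

theorem Ad_inv_Ad_apply (g : G) (x : LieAlg E G) : Ad g⁻¹ (Ad g x) = x := by
  rw [← Ad_mul_apply, inv_mul_cancel, Ad_one]
  rfl

theorem Ad_Ad_inv_apply (g : G) (x : LieAlg E G) : Ad g (Ad g⁻¹ x) = x := by
  rw [← Ad_mul_apply, mul_inv_cancel, Ad_one]
  rfl

/-- The pullback of a left invariant vector field under a conjugation is left invariant. -/
theorem mpullback_conj_mulInvariantVectorField (g : G) (v : LieAlg E G) :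
    mpullback 𝓘(ℂ, E) 𝓘(ℂ, E) (fun x : G => g * x * g⁻¹)
        (mulInvariantVectorField (I := 𝓘(ℂ, E)) (G := G) (toGroupLieAlgebra v))
      = mulInvariantVectorField (I := 𝓘(ℂ, E)) (G := G) (toGroupLieAlgebra (Ad g⁻¹ v)) := by
  ext h
  have hmul : ∀ a b : G, MDifferentiableAt 𝓘(ℂ, E) 𝓘(ℂ, E) (fun x : G => a * x) b := fun a b =>
    (contMDiff_mul_left (n := ω)).mdifferentiable (by simp) b
  have h3 : ∀ y : G, y = h → (mfderiv 𝓘(ℂ, E) 𝓘(ℂ, E) (fun x : G => g * x * g⁻¹) y : E →L[ℂ] E)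
      = (mfderiv 𝓘(ℂ, E) 𝓘(ℂ, E) (fun x : G => g * x * g⁻¹) h : E →L[ℂ] E) := by
    rintro y rfl
    rfl
  have hinv : (mfderiv 𝓘(ℂ, E) 𝓘(ℂ, E) (fun x : G => g * x * g⁻¹) h).IsInvertible := by
    have hid : ∀ a b : G, a * b = 1 → ∀ y : G, ((mfderiv 𝓘(ℂ, E) 𝓘(ℂ, E)
        (fun x : G => a * x * a⁻¹) (b * y * b⁻¹)).comp
          (mfderiv 𝓘(ℂ, E) 𝓘(ℂ, E) (fun x : G => b * x * b⁻¹) y) : E →L[ℂ] E)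
        = ContinuousLinearMap.id ℂ E := by
      intro a b hab y
      have h1 : (fun x : G => a * x * a⁻¹) ∘ (fun x : G => b * x * b⁻¹) = id := by
        have hb : b = a⁻¹ := (inv_eq_of_mul_eq_one_right hab).symm
        subst hb
        ext x
        simp [mul_assoc]
      have h2 := mfderiv_comp (I' := 𝓘(ℂ, E)) y (mdifferentiableAt_conj E a (b * y * b⁻¹))
        (mdifferentiableAt_conj E b y)
      rw [h1, mfderiv_id] at h2
      exact h2.symm
    have h1 := hid g⁻¹ g (by simp) h
    have h2 := hid g g⁻¹ (by simp) (g * h * g⁻¹)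
    have h4 := h3 (g⁻¹ * (g * h * g⁻¹) * g⁻¹⁻¹) (by group)
    exact ContinuousLinearMap.IsInvertible.of_inverse
      ((congrArg (fun T : E →L[ℂ] E => T.comp (mfderiv 𝓘(ℂ, E) 𝓘(ℂ, E)
        (fun x : G => g⁻¹ * x * g⁻¹⁻¹) (g * h * g⁻¹) : E →L[ℂ] E)) h4).symm.trans h2) h1
  -- The chain rule for `g (h x) g⁻¹ = (g h g⁻¹) (g x g⁻¹)` shows that the derivative of the
  -- conjugation at `h` maps the field of `Ad(g)⁻¹ v` to the field of `v`.
  have h1 : (fun x : G => g * x * g⁻¹) ∘ (fun x : G => h * x)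
      = (fun x : G => g * h * g⁻¹ * x) ∘ fun x : G => g * x * g⁻¹ := by
    ext x
    simp [mul_assoc]
  have h2 := mfderiv_comp (I' := 𝓘(ℂ, E)) (1 : G) (mdifferentiableAt_conj E g (h * 1)) (hmul h 1)
  rw [h1] at h2
  have h5 := mfderiv_comp (I' := 𝓘(ℂ, E)) (1 : G) (hmul (g * h * g⁻¹) (g * 1 * g⁻¹))
    (mdifferentiableAt_conj E g 1)
  have h4 := h5.symm.trans h2
  have h6 : (mfderiv 𝓘(ℂ, E) 𝓘(ℂ, E) (fun x : G => g * h * g⁻¹ * x) 1 : E →L[ℂ] E).comp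
        (mfderiv 𝓘(ℂ, E) 𝓘(ℂ, E) (fun x : G => g * x * g⁻¹) 1 : E →L[ℂ] E)
      = (mfderiv 𝓘(ℂ, E) 𝓘(ℂ, E) (fun x : G => g * x * g⁻¹) h : E →L[ℂ] E).comp
        (mfderiv 𝓘(ℂ, E) 𝓘(ℂ, E) (fun x : G => h * x) 1 : E →L[ℂ] E) := by
    rw [← h3 _ (mul_one h), ← mfderiv_of_eq_one _ (by simp : g * 1 * g⁻¹ = 1)]
    exact h4
  have h7 := DFunLike.congr_fun h6 (Ad g⁻¹ v : E)
  have h8 : mfderiv 𝓘(ℂ, E) 𝓘(ℂ, E) (fun x : G => g * h * g⁻¹ * x) 1 v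
      = mfderiv 𝓘(ℂ, E) 𝓘(ℂ, E) (fun x : G => g * x * g⁻¹) h
        (mfderiv 𝓘(ℂ, E) 𝓘(ℂ, E) (fun x : G => h * x) 1 (Ad g⁻¹ v)) := by
    refine Eq.trans ?_ h7
    exact congrArg (mfderiv 𝓘(ℂ, E) 𝓘(ℂ, E) (fun x : G => g * h * g⁻¹ * x) 1 : E →L[ℂ] E)
      (Ad_Ad_inv_apply g v).symm
  rw [mpullback_apply]
  have h9 := congrArg (mfderiv 𝓘(ℂ, E) 𝓘(ℂ, E) (fun x : G => g * x * g⁻¹) h).inverse h8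
  refine h9.trans ?_
  have h10 := hinv.inverse_comp_self
  exact DFunLike.congr_fun h10 _

/-- `Ad g` respects the bracket, because pulling back vector fields does. -/
theorem Ad_lie [FiniteDimensional ℂ E] (g : G) (x y : LieAlg E G) :
    Ad g ⁅x, y⁆ = ⁅Ad g x, Ad g y⁆ := by
  have : CompleteSpace E := FiniteDimensional.complete ℂ E
  have hone : ∀ v : GroupLieAlgebra 𝓘(ℂ, E) G, mulInvariantVectorField v (1 : G) = v := by
    intro v
    have h : (fun x : G => 1 * x) = id := by ext x; simp
    simp only [mulInvariantVectorField]
    rw [h, mfderiv_id]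
    rfl
  have h1 := mpullback_mlieBracket (n := ω) (f := fun z : G => g⁻¹ * z * g⁻¹⁻¹) (x₀ := 1)
    (mdifferentiableAt_mulInvariantVectorField (I := 𝓘(ℂ, E)) (G := G) (toGroupLieAlgebra x))
    (mdifferentiableAt_mulInvariantVectorField (I := 𝓘(ℂ, E)) (G := G) (toGroupLieAlgebra y))
    (((contMDiff_const.mul contMDiff_id).mul contMDiff_const).contMDiffAt) le_top
  rw [mpullback_conj_mulInvariantVectorField, mpullback_conj_mulInvariantVectorField,
    ← mulInvariantVector_mlieBracket] at h1
  have h2 := congrFun (mpullback_conj_mulInvariantVectorField (E := E) g⁻¹ ⁅x, y⁆) 1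
  have h3 := (h2.symm.trans h1).symm
  rw [hone, inv_inv] at h3
  exact h3.symm

/-- `Ad g` as an automorphism of the Lie algebra `𝔤`. -/
def adEquiv [FiniteDimensional ℂ E] (g : G) : LieAlg E G ≃ₗ⁅ℂ⁆ LieAlg E G where
  __ := (Ad g : LieAlg E G →L[ℂ] LieAlg E G).toLinearMap
  map_lie' {x y} := Ad_lie g x y
  invFun := Ad g⁻¹
  left_inv := Ad_inv_Ad_apply g
  right_inv := Ad_Ad_inv_apply g

/-- A non-degenerate form that is invariant under the simple Lie algebra `𝔤` is invariant under all
of `G`, even if `G` is not connected. -/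
theorem apply_Ad_inv [FiniteDimensional ℂ E] [LieAlgebra.IsSimple ℂ (LieAlg E G)]
    {B : LinearMap.BilinForm ℂ (LieAlg E G)} (hB : B.Nondegenerate)
    (hB_inv : B.lieInvariant (LieAlg E G)) (g : G) (x y : LieAlg E G) :
    B (Ad g⁻¹ x) y = B x (Ad g y) := by
  rw [← apply_equiv_apply_equiv hB hB_inv (adEquiv g) (Ad g⁻¹ x) y]
  exact congrArg (fun z => B z (Ad g y)) (Ad_Ad_inv_apply g x)

end AdjointRepresentation

/-! ### The left logarithmic derivative of a product and the action on the dual -/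

section LogarithmicDerivative

variable {S : Type*} [TopologicalSpace S] [ChartedSpace ℂ S]
  {E : Type*} [NormedAddCommGroup E] [NormedSpace ℂ E]
  {G : Type*} [TopologicalSpace G] [ChartedSpace E G] [Group G] [LieGroup 𝓘(ℂ, E) ω G]

/-- The differential `T_m S → 𝔤` at `m` of a map `f` with `f m = 1`, where `T_m S = ℂ` through the
preferred chart. -/
def modelDeriv (f : S → G) (m : S) : ℂ →L[ℝ] LieAlg E G :=
  show ℂ →L[ℝ] E from mfderiv 𝓘(ℝ, ℂ) 𝓘(ℝ, E) f m

theorem leftLogDeriv_eq_modelDeriv {f : S → G} (hf : ContMDiff 𝓘(ℝ, ℂ) 𝓘(ℝ, E) ∞ f) (m : S) :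
    inModel (leftLogDeriv (E := E) f) m = (modelDeriv (E := E) (fun y => (f m)⁻¹ * f y) m) :=
  (mfderiv_comp (I' := 𝓘(ℝ, E)) m (g := fun h : G => (f m)⁻¹ * h)
    ((contMDiff_mul_left (n := ∞)).mdifferentiable (by simp) _)
    (hf.mdifferentiable (by simp) _)).symm

/-- The derivative of the multiplication at `(1, 1)` is the addition. -/
theorem modelDeriv_mul {a b : S → G} (ha : ContMDiff 𝓘(ℝ, ℂ) 𝓘(ℝ, E) ∞ a)
    (hb : ContMDiff 𝓘(ℝ, ℂ) 𝓘(ℝ, E) ∞ b) {m : S} (ha1 : a m = 1) (hb1 : b m = 1) :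
    modelDeriv (E := E) (fun y => a y * b y) m
      = modelDeriv (E := E) a m + modelDeriv (E := E) b m := by
  ext v
  have hmul : MDifferentiableAt (𝓘(ℝ, E).prod 𝓘(ℝ, E)) 𝓘(ℝ, E) (fun p : G × G => p.1 * p.2)
      (a m, b m) := (contMDiff_mul 𝓘(ℝ, E) ∞).mdifferentiable (by simp) _
  have had := ha.mdifferentiable (by simp) m
  have hbd := hb.mdifferentiable (by simp) m
  have h1 := mfderiv_comp (I' := 𝓘(ℝ, E).prod 𝓘(ℝ, E)) m
    (f := fun y => (a y, b y)) (g := fun p : G × G => p.1 * p.2) hmul (had.prodMk hbd)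
  have h2 := DFunLike.congr_fun h1 v
  have h3 := mfderiv_prod_eq_add_apply (v := (mfderiv 𝓘(ℝ, ℂ) (𝓘(ℝ, E).prod 𝓘(ℝ, E))
    (fun y => (a y, b y)) m v)) hmul
  have hab : ∀ x : G, x = 1 → ∀ w : E,
      (mfderiv 𝓘(ℝ, E) 𝓘(ℝ, E) (fun z : G => z * x) 1 : E →L[ℝ] E) w = w ∧
      (mfderiv 𝓘(ℝ, E) 𝓘(ℝ, E) (fun z : G => x * z) 1 : E →L[ℝ] E) w = w := by
    rintro x rfl w
    have e1 : (fun z : G => z * 1) = id := by ext z; simp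
    have e2 : (fun z : G => 1 * z) = id := by ext z; simp
    rw [e1, e2, mfderiv_id]
    exact ⟨rfl, rfl⟩
  have h4 := mfderiv_prodMk had hbd
  have h5 := DFunLike.congr_fun h4 v
  have h6 := (hab (b m) hb1 (modelDeriv (E := E) a m v)).1
  have h7 := (hab (a m) ha1 (modelDeriv (E := E) b m v)).2
  rw [← mfderiv_of_eq_one _ ha1] at h6
  rw [← mfderiv_of_eq_one _ hb1] at h7
  have h8 := congrArg (fun w : E × E =>
    (mfderiv 𝓘(ℝ, E) 𝓘(ℝ, E) (fun z : G => z * b m) (a m) : E →L[ℝ] E) w.1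
      + (mfderiv 𝓘(ℝ, E) 𝓘(ℝ, E) (fun z : G => a m * z) (b m) : E →L[ℝ] E) w.2) h5
  exact ((h2.trans h3).trans h8).trans (congrArg₂ (fun x y : E => x + y) h6 h7)

omit [LieGroup 𝓘(ℂ, E) ω G] [Group G] in
theorem mfderiv_real_eq_complex {F : G → G} {x : G}
    (hF : MDifferentiableAt 𝓘(ℂ, E) 𝓘(ℂ, E) F x) :
    (mfderiv 𝓘(ℝ, E) 𝓘(ℝ, E) F x : E →L[ℝ] E)
      = (mfderiv 𝓘(ℂ, E) 𝓘(ℂ, E) F x : E →L[ℂ] E).restrictScalars ℝ := by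
  have h := hF.hasMFDerivAt
  exact HasMFDerivAt.mfderiv (I := 𝓘(ℝ, E)) (I' := 𝓘(ℝ, E)) ⟨h.1, h.2.restrictScalars ℝ⟩

theorem modelDeriv_conj {a : S → G} (ha : ContMDiff 𝓘(ℝ, ℂ) 𝓘(ℝ, E) ∞ a) {m : S} (ha1 : a m = 1)
    (g : G) : modelDeriv (E := E) (fun y => g * a y * g⁻¹) m
      = (AdReal (E := E) g).comp (modelDeriv (E := E) a m) := by
  have hc : ContMDiff 𝓘(ℝ, E) 𝓘(ℝ, E) ∞ (fun x : G => g * x * g⁻¹) :=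
    (contMDiff_const.mul contMDiff_id).mul contMDiff_const
  have h1 := mfderiv_comp (I' := 𝓘(ℝ, E)) m (g := fun x : G => g * x * g⁻¹)
    (hc.mdifferentiable (by simp) _) (ha.mdifferentiable (by simp) m)
  refine h1.trans ?_
  have h2 := (mfderiv_of_eq_one (𝕜 := ℝ) (E := E) (fun x : G => g * x * g⁻¹) ha1).trans
    (mfderiv_real_eq_complex (mdifferentiableAt_conj E g 1))
  exact congrArg (fun T : E →L[ℝ] E => T.comp (modelDeriv (E := E) a m)) h2

/-- The product rule `(f h)⁻¹.d(f h) = h⁻¹.dh + Ad(h)⁻¹.(f⁻¹.df)`. -/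
theorem leftLogDeriv_mul {f h : S → G} (hf : ContMDiff 𝓘(ℝ, ℂ) 𝓘(ℝ, E) ∞ f)
    (hh : ContMDiff 𝓘(ℝ, ℂ) 𝓘(ℝ, E) ∞ h) :
    leftLogDeriv (E := E) (f * h)
      = leftLogDeriv h + fun m => (AdReal (h m)⁻¹).comp (leftLogDeriv f m) := by
  funext m
  have ha : ContMDiff 𝓘(ℝ, ℂ) 𝓘(ℝ, E) ∞ fun y => (f m)⁻¹ * f y := contMDiff_const.mul hf
  have hb : ContMDiff 𝓘(ℝ, ℂ) 𝓘(ℝ, E) ∞ fun y => (h m)⁻¹ * h y := contMDiff_const.mul hh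
  have h1 : (fun y => ((f * h) m)⁻¹ * (f * h) y)
      = fun y => ((h m)⁻¹ * ((f m)⁻¹ * f y) * (h m)⁻¹⁻¹) * ((h m)⁻¹ * h y) := by
    ext y
    simp [mul_assoc]
  have h2 := leftLogDeriv_eq_modelDeriv (E := E) (hf.mul hh) m
  have h3 : modelDeriv (E := E) (fun y => ((f * h) m)⁻¹ * (f * h) y) m
      = inModel (leftLogDeriv (E := E) h) m
        + (AdReal (E := E) (h m)⁻¹).comp (inModel (leftLogDeriv (E := E) f) m) := by
    have hc : ContMDiff 𝓘(ℝ, ℂ) 𝓘(ℝ, E) ∞ fun y => (h m)⁻¹ * ((f m)⁻¹ * f y) * (h m)⁻¹⁻¹ :=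
      (contMDiff_const.mul ha).mul contMDiff_const
    rw [h1, modelDeriv_mul hc hb (by simp) (by simp), modelDeriv_conj ha (by simp), add_comm,
      leftLogDeriv_eq_modelDeriv hf, leftLogDeriv_eq_modelDeriv hh]
  exact h2.trans h3

omit [LieGroup 𝓘(ℂ, E) ω G] in
theorem leftLogDeriv_one : leftLogDeriv (E := E) (1 : S → G) = 0 := by
  funext m
  unfold leftLogDeriv
  have : mfderiv 𝓘(ℝ, ℂ) 𝓘(ℝ, E) (1 : S → G) m = 0 := mfderiv_const
  rw [this]
  exact ContinuousLinearMap.comp_zero _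

variable [IsManifold 𝓘(ℂ) ω S]

theorem dbarLog_one : dbarLog (1 : CurrentGroup S E G) = 0 := by
  refine Subtype.ext ?_
  change antiPart (leftLogDeriv (E := E) (1 : S → G)) = 0
  rw [leftLogDeriv_one]
  funext m
  ext v
  simp [antiPart]

theorem adForm_one (ξ : Omega01 S (LieAlg E G)) : adForm (1 : CurrentGroup S E G) ξ = ξ := by
  refine Subtype.ext (funext fun m => ContinuousLinearMap.ext fun v => ?_)
  change Ad (1 : G) (ξ.1 m v) = _
  rw [Ad_one]
  rfl

theorem adForm_mul (f h : CurrentGroup S E G) (ξ : Omega01 S (LieAlg E G)) :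
    adForm (f * h) ξ = adForm f (adForm h ξ) :=
  Subtype.ext (funext fun m => ContinuousLinearMap.ext fun v => Ad_mul_apply (f m) (h m) (ξ.1 m v))

theorem adForm_add (f : CurrentGroup S E G) (ξ ζ : Omega01 S (LieAlg E G)) :
    adForm f (ξ + ζ) = adForm f ξ + adForm f ζ :=
  Subtype.ext (funext fun m => ContinuousLinearMap.ext fun v =>
    (Ad (f m)).map_add (ξ.1 m v) (ζ.1 m v))

theorem adForm_smul (f : CurrentGroup S E G) (c : ℂ) (ξ : Omega01 S (LieAlg E G)) :
    adForm f (c • ξ) = c • adForm f ξ :=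
  Subtype.ext (funext fun m => ContinuousLinearMap.ext fun v => (Ad (f m)).map_smul c (ξ.1 m v))

theorem dbarLog_mul (f h : CurrentGroup S E G) :
    dbarLog (f * h) = dbarLog h + adForm h⁻¹ (dbarLog f) := by
  refine Subtype.ext ?_
  change antiPart (leftLogDeriv (E := E) ((f : S → G) * (h : S → G))) = _
  rw [leftLogDeriv_mul f.contMDiff h.contMDiff]
  funext m
  ext v
  have hI := (Ad (h m)⁻¹).map_smul Complex.I (leftLogDeriv (E := E) f m (complexStructure m v))
  have h2 := (Ad (h m)⁻¹).map_smul (1 / 2 : ℂ) (leftLogDeriv (E := E) f m v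
    + Complex.I • leftLogDeriv f m (complexStructure m v))
  have h3 := (Ad (h m)⁻¹).map_add (leftLogDeriv (E := E) f m v)
    (Complex.I • leftLogDeriv (E := E) f m (complexStructure m v))
  rw [h3, hI] at h2
  change (1 / 2 : ℂ) • ((leftLogDeriv (E := E) h m v + Ad (h m)⁻¹ (leftLogDeriv (E := E) f m v))
      + Complex.I • (leftLogDeriv (E := E) h m (complexStructure m v)
        + Ad (h m)⁻¹ (leftLogDeriv (E := E) f m (complexStructure m v))))
    = (1 / 2 : ℂ) • (leftLogDeriv (E := E) h m v
      + Complex.I • leftLogDeriv (E := E) h m (complexStructure m v))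
      + Ad (h m)⁻¹ ((1 / 2 : ℂ) • (leftLogDeriv (E := E) f m v
        + Complex.I • leftLogDeriv (E := E) f m (complexStructure m v)))
  refine Eq.trans ?_ (congrArg (_ + ·) h2.symm)
  module

theorem dualAct_one (e : DualSpace S E G) : dualAct e 1 = e := by
  refine Prod.ext rfl ?_
  simp only [dualAct, dbarLog_one, smul_zero, zero_add, inv_one, adForm_one]

theorem dualAct_mul (e : DualSpace S E G) (f h : CurrentGroup S E G) :
    dualAct e (f * h) = dualAct (dualAct e f) h := by
  refine Prod.ext rfl ?_
  simp only [dualAct, dbarLog_mul, mul_inv_rev, adForm_mul, adForm_add, adForm_smul, smul_add]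
  abel

end LogarithmicDerivative

/-! ### One-forms in holomorphic coordinates -/

section Coordinates

variable {S : Type*} [TopologicalSpace S] [ChartedSpace ℂ S]
  {V : Type*} [NormedAddCommGroup V] [NormedSpace ℂ V]
  {W : Type*} [NormedAddCommGroup W] [NormedSpace ℂ W]

/-- The 1-form `α` at `m`, read in the preferred chart at `p`; this is meaningful for `m` in the
domain of that chart. -/
def inChart [IsManifold 𝓘(ℂ) ω S] (α : OneForm S V) (p m : S) : ℂ →L[ℝ] V :=
  (inModel α m).comp (tangentCoordChange 𝓘(ℝ, ℂ) p m m)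

/-- The coordinate vector `∂/∂x` at `m` of the preferred chart at `p`. -/
def coordVector [IsManifold 𝓘(ℂ) ω S] (p m : S) : ℂ :=
  tangentCoordChange 𝓘(ℝ, ℂ) p m m 1

variable [IsManifold 𝓘(ℂ) ω S]

theorem tangentCoordChange_I_one {p m : S} (hm : m ∈ (chartAt ℂ p).source) :
    tangentCoordChange 𝓘(ℝ, ℂ) p m m Complex.I = Complex.I * coordVector p m := by
  rw [coordVector, ← tangentCoordChange_I hm, mul_one]

theorem coordVector_ne_zero {p m : S} (hm : m ∈ (chartAt ℂ p).source) : coordVector p m ≠ 0 := by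
  intro h
  have h1 := tangentCoordChange_comp (I := 𝓘(ℝ, ℂ)) (w := p) (x := m) (y := p) (z := m) (v := 1)
    (by simpa using hm)
  rw [tangentCoordChange_self (by simpa using hm), ← coordVector, h, map_zero] at h1
  exact zero_ne_one h1

/-- The coordinate vector fields in the definition of `surfaceIntegral` are given by the coordinate
changes of the tangent bundle. -/
theorem mfderiv_chartAt_symm {p : S} {z : ℂ} (hz : z ∈ (chartAt ℂ p).target) :
    (mfderiv 𝓘(ℝ, ℂ) 𝓘(ℝ, ℂ) (chartAt ℂ p).symm z : ℂ →L[ℝ] ℂ)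
      = tangentCoordChange 𝓘(ℝ, ℂ) p ((chartAt ℂ p).symm z) ((chartAt ℂ p).symm z) := by
  have h : MDifferentiableAt 𝓘(ℝ, ℂ) 𝓘(ℝ, ℂ) (chartAt ℂ p).symm z :=
    mdifferentiableAt_atlas_symm (chart_mem_atlas ℂ p) hz
  have h1 : (mfderiv 𝓘(ℝ, ℂ) 𝓘(ℝ, ℂ) (chartAt ℂ p).symm z : ℂ →L[ℝ] ℂ)
      = fderivWithin ℝ (writtenInExtChartAt 𝓘(ℝ, ℂ) 𝓘(ℝ, ℂ) z (chartAt ℂ p).symm)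
        (Set.range 𝓘(ℝ, ℂ)) (extChartAt 𝓘(ℝ, ℂ) z z) := if_pos h
  rw [tangentCoordChange_def, h1]
  simp [writtenInExtChartAt, hz, Function.comp_def, chartAt_self_eq]
  rfl

theorem IsSmoothOneForm.contMDiffOn_inChart {α : OneForm S V} (hα : IsSmoothOneForm α) (p : S) :
    ContMDiffOn 𝓘(ℝ, ℂ) 𝓘(ℝ, ℂ →L[ℝ] V) ∞ (inChart α p) (chartAt ℂ p).source := by
  intro m₀ hm₀
  refine ContMDiffAt.contMDiffWithinAt ?_
  have h1 := (isSmoothOneForm_iff α).1 hα m₀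
  have h2 : ContMDiffAt 𝓘(ℝ, ℂ) 𝓘(ℝ, ℂ →L[ℝ] ℂ) ∞ (tangentCoordChange 𝓘(ℝ, ℂ) p m₀) m₀ := by
    have : IsManifold 𝓘(ℝ, ℂ) (∞ + 1) S := inferInstanceAs (IsManifold 𝓘(ℝ, ℂ) ∞ S)
    have := tangentBundleCore.isContMDiff (I := 𝓘(ℝ, ℂ)) (M := S) (n := ∞)
    have := VectorBundleCore.IsContMDiff.contMDiffOn_coordChange (n := ∞) (IB := 𝓘(ℝ, ℂ))
      (Z := tangentBundleCore 𝓘(ℝ, ℂ) S) (achart ℂ p) (achart ℂ m₀)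
    refine (this m₀ ⟨hm₀, mem_chart_source ℂ m₀⟩).contMDiffAt ?_
    exact ((chartAt ℂ p).open_source.inter (chartAt ℂ m₀).open_source).mem_nhds
      ⟨hm₀, mem_chart_source ℂ m₀⟩
  refine (h1.clm_comp h2).congr_of_eventuallyEq ?_
  filter_upwards [(chartAt ℂ p).open_source.mem_nhds hm₀,
    (chartAt ℂ m₀).open_source.mem_nhds (mem_chart_source ℂ m₀)] with m hm hm'
  ext v
  exact congrArg (inModel α m) (tangentCoordChange_comp (I := 𝓘(ℝ, ℂ)) (by simp [hm, hm'])).symm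

/-- The variant of `IsSmoothOneForm.clm_comp` in which the values may change their space. -/
theorem IsSmoothOneForm.comp_clm {A : S → V →L[ℝ] W}
    (hA : ContMDiff 𝓘(ℝ, ℂ) 𝓘(ℝ, V →L[ℝ] W) ∞ A) {α : OneForm S V} (hα : IsSmoothOneForm α) :
    IsSmoothOneForm fun m => (A m).comp (α m) :=
  (isSmoothOneForm_iff _).2 fun m₀ => (hA m₀).clm_comp ((isSmoothOneForm_iff α).1 hα m₀)

/-- Holomorphy of a 1-form at `m₀`, read in the preferred chart at `m₀`. -/
theorem IsHolomorphicOneForm.contMDiffAt {η : ∀ m : S, TangentSpace 𝓘(ℂ) m →L[ℂ] ℂ}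
    (hη : IsHolomorphicOneForm η) (m₀ : S) :
    ContMDiffAt 𝓘(ℂ) 𝓘(ℂ, ℂ →L[ℂ] ℂ) ω
      (fun m : S => (show ℂ →L[ℂ] ℂ from η m).comp (tangentCoordChange 𝓘(ℂ) m₀ m m)) m₀ := by
  have h := hη m₀
  rw [contMDiffAt_hom_bundle] at h
  refine h.2.congr_of_eventuallyEq ?_
  filter_upwards [(chartAt ℂ m₀).open_source.mem_nhds (mem_chart_source ℂ m₀)] with m hm
  have h1 := TangentBundle.symmL_trivializationAt_eq_core (I := 𝓘(ℂ)) hm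
  have h2 := Bundle.Trivial.continuousLinearMapAt_trivialization (𝕜 := ℂ) (B := S) (F := ℂ) m
  exact ((congrArg (fun T : ℂ →L[ℂ] ℂ => T.comp ((show ℂ →L[ℂ] ℂ from η m).comp
      ((trivializationAt ℂ (TangentSpace 𝓘(ℂ) (M := S)) m₀).symmL ℂ m))) h2).trans
    (congrArg (fun T : ℂ →L[ℂ] ℂ => (show ℂ →L[ℂ] ℂ from η m).comp T) h1)).symm

theorem tangentCoordChange_real_eq_complex {p m : S} (hm : m ∈ (chartAt ℂ p).source) :
    tangentCoordChange 𝓘(ℝ, ℂ) p m m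
      = (tangentCoordChange 𝓘(ℂ) p m m).restrictScalars ℝ := by
  have h : HasFDerivWithinAt (extChartAt 𝓘(ℂ) m ∘ (extChartAt 𝓘(ℂ) p).symm)
      (tangentCoordChange 𝓘(ℂ) p m m) (Set.range 𝓘(ℂ)) (extChartAt 𝓘(ℂ) p m) :=
    hasFDerivWithinAt_tangentCoordChange (by simp [hm])
  exact (h.restrictScalars ℝ).fderivWithin (by simp)

theorem IsHolomorphicOneForm.isSmoothOneForm {η : ∀ m : S, TangentSpace 𝓘(ℂ) m →L[ℂ] ℂ}
    (hη : IsHolomorphicOneForm η) : IsSmoothOneForm (realForm η) := by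
  refine (isSmoothOneForm_iff _).2 fun m₀ => ?_
  have h := hη.contMDiffAt m₀
  have h1 : ContMDiffAt 𝓘(ℝ, ℂ) 𝓘(ℝ, ℂ →L[ℂ] ℂ) ∞
      (fun m : S => (show ℂ →L[ℂ] ℂ from η m).comp (tangentCoordChange 𝓘(ℂ) m₀ m m)) m₀ := by
    rw [contMDiffAt_iff] at h ⊢
    exact ⟨h.1, (h.2.restrict_scalars ℝ).of_le le_top⟩
  have h2 := (ContinuousLinearMap.restrictScalarsL ℂ ℂ ℂ ℝ ℝ).contMDiff.contMDiffAt.comp m₀ h1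
  refine h2.congr_of_eventuallyEq ?_
  filter_upwards [(chartAt ℂ m₀).open_source.mem_nhds (mem_chart_source ℂ m₀)] with m hm
  have h3 := tangentCoordChange_real_eq_complex hm
  exact congrArg (fun T : ℂ →L[ℝ] ℂ => (inModel (realForm η) m).comp T) h3

/-- The form `conj(α) ⊗ Y`. -/
theorem IsSmoothOneForm.star_smul {α : OneForm S ℂ} (hα : IsSmoothOneForm α) {Y : S → V}
    (hY : ContMDiff 𝓘(ℝ, ℂ) 𝓘(ℝ, V) ∞ Y) :
    IsSmoothOneForm fun m => (((ContinuousLinearMap.lsmul ℝ ℂ).flip (Y m)).comp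
      (Complex.conjCLE : ℂ →L[ℝ] ℂ)).comp (α m) := by
  have h : ContMDiff 𝓘(ℝ, ℂ) 𝓘(ℝ, ℂ →L[ℝ] V) ∞ fun m =>
      ((ContinuousLinearMap.lsmul ℝ ℂ).flip (Y m)).comp (Complex.conjCLE : ℂ →L[ℝ] ℂ) :=
    (((ContinuousLinearMap.lsmul ℝ ℂ).flip : V →L[ℝ] ℂ →L[ℝ] V).contMDiff.comp hY).clm_comp
      contMDiff_const
  exact hα.comp_clm h

end Coordinates

/-! ### Linearity and positivity of the integral over the surface -/

section SurfaceIntegral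

variable {S : Type*} [TopologicalSpace S] [ChartedSpace ℂ S] [IsManifold 𝓘(ℂ) ω S]

/-- The coefficient of `dx ∧ dy` of the 2-form `τ` at `m`, in the preferred chart at `p`. -/
def chartCoeff (τ : TwoForm S) (p m : S) : ℂ :=
  τ m ![(show ℂ from tangentCoordChange 𝓘(ℝ, ℂ) p m m 1),
    (show ℂ from tangentCoordChange 𝓘(ℝ, ℂ) p m m Complex.I)]

/-- A 2-form is continuous if its coefficients in the preferred charts are. -/
def IsContinuousTwoForm (τ : TwoForm S) : Prop :=
  ∀ p : S, ContinuousOn (chartCoeff τ p) (chartAt ℂ p).source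

theorem isContinuousTwoForm_wedge {α β : OneForm S ℂ} (hα : IsSmoothOneForm α)
    (hβ : IsSmoothOneForm β) : IsContinuousTwoForm (wedge α β) := by
  intro p
  have h : ∀ {γ : OneForm S ℂ}, IsSmoothOneForm γ → ∀ v : ℂ,
      ContinuousOn (fun m => inChart γ p m v) (chartAt ℂ p).source := fun hγ v =>
    (hγ.contMDiffOn_inChart p).continuousOn.clm_apply continuousOn_const
  exact ((h hα 1).mul (h hβ Complex.I)).sub ((h hα Complex.I).mul (h hβ 1))

omit [IsManifold 𝓘(ℂ) ω S] in
theorem wedge_add (α β γ : OneForm S ℂ) : wedge α (β + γ) = wedge α β + wedge α γ := by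
  funext m
  ext v
  simp [wedge]
  ring

omit [IsManifold 𝓘(ℂ) ω S] in
theorem wedge_smul (α β : OneForm S ℂ) (c : ℂ) : wedge α (c • β) = c • wedge α β := by
  funext m
  ext v
  simp [wedge]
  ring

variable [CompactSpace S] [T2Space S]

/-- The function that is integrated over the chart at `p` in the definition of
`surfaceIntegral`. -/
def chartIntegrand (τ : TwoForm S) (p : S) (z : ℂ) : ℂ :=
  (chartPartition S p ((chartAt ℂ p).symm z) : ℂ) * chartCoeff τ p ((chartAt ℂ p).symm z)

variable (S) in
theorem finite_chartPartition_ne_zero :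
    {p : S | (Function.support (chartPartition S p)).Nonempty}.Finite :=
  (chartPartition S).locallyFinite.finite_nonempty_of_compact

theorem surfaceIntegral_eq_sum (τ : TwoForm S) :
    surfaceIntegral τ = ∑ p ∈ (finite_chartPartition_ne_zero S).toFinset,
      ∫ z in (chartAt ℂ p).target, chartIntegrand τ p z := by
  have h : ∀ p : S, (∫ z in (chartAt ℂ p).target,
      (chartPartition S p ((chartAt ℂ p).symm z) : ℂ) *
        τ ((chartAt ℂ p).symm z)
          ![mfderiv 𝓘(ℝ, ℂ) 𝓘(ℝ, ℂ) (chartAt ℂ p).symm z (1 : ℂ),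
            mfderiv 𝓘(ℝ, ℂ) 𝓘(ℝ, ℂ) (chartAt ℂ p).symm z Complex.I])
      = ∫ z in (chartAt ℂ p).target, chartIntegrand τ p z := fun p => by
    refine MeasureTheory.setIntegral_congr_fun (chartAt ℂ p).open_target.measurableSet
      fun z hz => ?_
    have h1 := mfderiv_chartAt_symm hz
    exact congrArg (fun T : ℂ →L[ℝ] ℂ => (chartPartition S p ((chartAt ℂ p).symm z) : ℂ) *
      τ ((chartAt ℂ p).symm z) ![(show ℂ from T 1), (show ℂ from T Complex.I)]) h1
  rw [surfaceIntegral, finsum_congr h]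
  refine finsum_eq_sum_of_support_subset _ fun p hp => ?_
  rw [Set.Finite.coe_toFinset]
  by_contra hne
  rw [Set.mem_ofPred_eq, Set.not_nonempty_iff_eq_empty, Function.support_eq_empty_iff] at hne
  refine hp ?_
  have : chartIntegrand τ p = 0 := by
    funext z
    simp [chartIntegrand, hne]
  simp [this]

theorem continuousOn_chartIntegrand {τ : TwoForm S} (hτ : IsContinuousTwoForm τ) (p : S) :
    ContinuousOn (chartIntegrand τ p) (chartAt ℂ p).target := by
  have h1 : ContinuousOn (fun z => chartCoeff τ p ((chartAt ℂ p).symm z)) (chartAt ℂ p).target :=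
    (hτ p).comp (chartAt ℂ p).continuousOn_symm (chartAt ℂ p).mapsTo_symm
  have h2 : Continuous fun m => (chartPartition S p m : ℂ) :=
    Complex.continuous_ofReal.comp (chartPartition S p).contMDiff.continuous
  exact (h2.comp_continuousOn (chartAt ℂ p).continuousOn_symm).mul h1

/-- The integrand is continuous and vanishes outside the compact image of the support of the
partition function. -/
theorem integrableOn_chartIntegrand {τ : TwoForm S} (hτ : IsContinuousTwoForm τ) (p : S) :
    MeasureTheory.IntegrableOn (chartIntegrand τ p) (chartAt ℂ p).target := by
  have hsub : tsupport (chartPartition S p) ⊆ (chartAt ℂ p).source :=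
    chartPartition_isSubordinate p
  have hK : IsCompact ((chartAt ℂ p) '' tsupport (chartPartition S p)) :=
    (isClosed_tsupport _).isCompact.image_of_continuousOn ((chartAt ℂ p).continuousOn.mono hsub)
  have hKt : (chartAt ℂ p) '' tsupport (chartPartition S p) ⊆ (chartAt ℂ p).target := by
    rintro _ ⟨m, hm, rfl⟩
    exact (chartAt ℂ p).map_source (hsub hm)
  refine (((continuousOn_chartIntegrand hτ p).mono
    hKt).integrableOn_compact hK).of_forall_sdiff_eq_zero
    (chartAt ℂ p).open_target.measurableSet fun z hz => ?_
  have : chartPartition S p ((chartAt ℂ p).symm z) = 0 := by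
    by_contra h
    exact hz.2 ⟨_, subset_tsupport _ h, (chartAt ℂ p).right_inv hz.1⟩
  simp [chartIntegrand, this]

theorem surfaceIntegral_add {σ τ : TwoForm S} (hσ : IsContinuousTwoForm σ)
    (hτ : IsContinuousTwoForm τ) :
    surfaceIntegral (σ + τ) = surfaceIntegral σ + surfaceIntegral τ := by
  simp only [surfaceIntegral_eq_sum, ← Finset.sum_add_distrib]
  refine Finset.sum_congr rfl fun p _ => ?_
  rw [← MeasureTheory.integral_add (integrableOn_chartIntegrand hσ p)
    (integrableOn_chartIntegrand hτ p)]
  refine MeasureTheory.integral_congr_ae (.of_forall fun z => ?_)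
  simp [chartIntegrand, chartCoeff, mul_add]

theorem surfaceIntegral_smul (τ : TwoForm S) (c : ℂ) :
    surfaceIntegral (c • τ) = c * surfaceIntegral τ := by
  simp only [surfaceIntegral_eq_sum, Finset.mul_sum]
  refine Finset.sum_congr rfl fun p _ => ?_
  rw [← MeasureTheory.integral_const_mul]
  refine MeasureTheory.integral_congr_ae (.of_forall fun z => ?_)
  simp [chartIntegrand, chartCoeff]
  ring

omit [CompactSpace S] [T2Space S] in
/-- A form `α` of type `(1,0)` and a form `β` of type `(0,1)` satisfy
`(α ∧ β)(∂/∂x, ∂/∂y) = -2i |w|² α(1) β(1)`, where `w` is the coordinate vector `∂/∂x`. -/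
theorem chartCoeff_wedge {α β : OneForm S ℂ}
    (hα : ∀ m (v : ℂ), inModel α m v = v * inModel α m 1)
    (hβ : ∀ m (v : ℂ), inModel β m v = starRingEnd ℂ v * inModel β m 1)
    {p m : S} (hm : m ∈ (chartAt ℂ p).source) :
    chartCoeff (wedge α β) p m
      = -2 * Complex.I * (Complex.normSq (coordVector p m) * (inModel α m 1 * inModel β m 1)) := by
  have h : chartCoeff (wedge α β) p m
      = inModel α m (coordVector p m) * inModel β m (tangentCoordChange 𝓘(ℝ, ℂ) p m m Complex.I)
        - inModel α m (tangentCoordChange 𝓘(ℝ, ℂ) p m m Complex.I)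
          * inModel β m (coordVector p m) := rfl
  rw [h, tangentCoordChange_I_one hm, hα m (coordVector p m), hβ m (coordVector p m),
    hα m (Complex.I * _), hβ m (Complex.I * _), map_mul, Complex.conj_I, ← Complex.mul_conj]
  ring

/-- If `α` has type `(1,0)`, `β` has type `(0,1)` and `α(1) β(1)` is a non-negative function, then
`∫ α ∧ β` is `-2i` times the integral of a non-negative density, so that it vanishes only if the
density does. -/
theorem eq_zero_of_surfaceIntegral_wedge {α β : OneForm S ℂ}
    (hα : ∀ m (v : ℂ), inModel α m v = v * inModel α m 1)
    (hβ : ∀ m (v : ℂ), inModel β m v = starRingEnd ℂ v * inModel β m 1)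
    (hα_smooth : IsSmoothOneForm α) (hβ_smooth : IsSmoothOneForm β) {r : S → ℝ}
    (hr : ∀ m, 0 ≤ r m) (h : ∀ m, inModel α m 1 * inModel β m 1 = r m)
    (h0 : surfaceIntegral (wedge α β) = 0) (m : S) : r m = 0 := by
  have hcont := isContinuousTwoForm_wedge hα_smooth hβ_smooth
  let g : S → ℂ → ℝ := fun p z => chartPartition S p ((chartAt ℂ p).symm z) *
    (Complex.normSq (coordVector p ((chartAt ℂ p).symm z)) * r ((chartAt ℂ p).symm z))
  have hg0 : ∀ p z, 0 ≤ g p z := fun p z => mul_nonneg ((chartPartition S).nonneg p _)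
    (mul_nonneg (Complex.normSq_nonneg _) (hr _))
  have hg : ∀ p, ∀ z ∈ (chartAt ℂ p).target,
      chartIntegrand (wedge α β) p z = -2 * Complex.I * (g p z : ℂ) := fun p z hz => by
    rw [chartIntegrand, chartCoeff_wedge hα hβ ((chartAt ℂ p).map_target hz), h]
    simp only [g]
    push_cast
    ring
  have hg' : ∀ p, ∀ z ∈ (chartAt ℂ p).target,
      g p z = (Complex.I / 2 * chartIntegrand (wedge α β) p z).re := fun p z hz => by
    rw [hg p z hz, show Complex.I / 2 * (-2 * Complex.I * (g p z : ℂ))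
      = -(Complex.I * Complex.I) * (g p z : ℂ) by ring, Complex.I_mul_I, neg_neg, one_mul,
      Complex.ofReal_re]
  have hint : ∀ p, ∫ z in (chartAt ℂ p).target, chartIntegrand (wedge α β) p z
      = -2 * Complex.I * ((∫ z in (chartAt ℂ p).target, g p z : ℝ) : ℂ) := fun p => by
    rw [MeasureTheory.setIntegral_congr_fun (chartAt ℂ p).open_target.measurableSet (hg p),
      MeasureTheory.integral_const_mul, integral_complex_ofReal]
  rw [surfaceIntegral_eq_sum, Finset.sum_congr rfl fun p _ => hint p, ← Finset.mul_sum,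
    ← Complex.ofReal_sum] at h0
  have hsum : ∑ p ∈ (finite_chartPartition_ne_zero S).toFinset,
      ∫ z in (chartAt ℂ p).target, g p z = 0 := by
    have := (mul_eq_zero.1 h0).resolve_left (by simp)
    exact_mod_cast this
  obtain ⟨p, hp⟩ := (chartPartition S).exists_pos_of_mem (Set.mem_univ m)
  have hm : m ∈ (chartAt ℂ p).source :=
    chartPartition_isSubordinate p (subset_tsupport _ hp.ne')
  have hz : (chartAt ℂ p) m ∈ (chartAt ℂ p).target := (chartAt ℂ p).map_source hm
  have hpmem : p ∈ (finite_chartPartition_ne_zero S).toFinset := by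
    rw [Set.Finite.mem_toFinset]
    exact ⟨m, hp.ne'⟩
  have hp0 : ∫ z in (chartAt ℂ p).target, g p z = 0 :=
    (Finset.sum_eq_zero_iff_of_nonneg fun p _ =>
      MeasureTheory.integral_nonneg (hg0 p)).1 hsum p hpmem
  have hgc : ContinuousOn (g p) (chartAt ℂ p).target :=
    (Complex.continuous_re.comp_continuousOn
      (continuousOn_const.mul (continuousOn_chartIntegrand hcont p))).congr (hg' p)
  have hgi : MeasureTheory.IntegrableOn (g p) (chartAt ℂ p).target := by
    have h1 : MeasureTheory.IntegrableOn
        (fun z => (Complex.I / 2 * chartIntegrand (wedge α β) p z).re) (chartAt ℂ p).target :=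
      ((integrableOn_chartIntegrand hcont p).const_mul (Complex.I / 2)).re
    exact h1.congr_fun (fun z hz => (hg' p z hz).symm) (chartAt ℂ p).open_target.measurableSet
  have hae := (MeasureTheory.setIntegral_eq_zero_iff_of_nonneg_ae
    (.of_forall fun z => hg0 p z) hgi).1 hp0
  have hzero := MeasureTheory.Measure.eqOn_open_of_ae_eq hae (chartAt ℂ p).open_target hgc
    continuousOn_const hz
  have h2 : chartPartition S p m * (Complex.normSq (coordVector p m) * r m) = 0 := by
    simpa [g, (chartAt ℂ p).left_inv hm] using hzero
  exact ((mul_eq_zero.1 ((mul_eq_zero.1 h2).resolve_left hp.ne')).resolve_left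
    (by simpa using coordVector_ne_zero hm))

end SurfaceIntegral

/-! ### Zeros of holomorphic one-forms -/

section Zeros

variable {S : Type*} [TopologicalSpace S] [ChartedSpace ℂ S] [IsManifold 𝓘(ℂ) ω S]
  {η : ∀ m : S, TangentSpace 𝓘(ℂ) m →L[ℂ] ℂ}

omit [IsManifold 𝓘(ℂ) ω S] in
theorem inModel_realForm (η : ∀ m : S, TangentSpace 𝓘(ℂ) m →L[ℂ] ℂ) (m : S) (v : ℂ) :
    inModel (realForm η) m v = v * inModel (realForm η) m 1 := by
  have h := (show ℂ →L[ℂ] ℂ from η m).map_smul v 1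
  rw [smul_eq_mul, smul_eq_mul, mul_one] at h
  exact h

/-- A holomorphic 1-form either vanishes near a point or has no zeros in a punctured neighbourhood
of the point. -/
theorem IsHolomorphicOneForm.eventually_eq_or_eventually_ne (hη : IsHolomorphicOneForm η)
    (m₀ : S) :
    (∀ᶠ m in nhds m₀, inModel (realForm η) m 1 = 0) ∨
      ∀ᶠ m in nhdsWithin m₀ {m₀}ᶜ, inModel (realForm η) m 1 ≠ 0 := by
  let c := chartAt ℂ m₀
  have hm₀ : m₀ ∈ c.source := mem_chart_source ℂ m₀
  let F : S → ℂ := fun m => inModel (realForm η) m (coordVector m₀ m)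
  have hF : ∀ m ∈ c.source, (F m = 0 ↔ inModel (realForm η) m 1 = 0) := fun m hm => by
    simp only [F]
    rw [inModel_realForm η m (coordVector m₀ m), mul_eq_zero]
    exact or_iff_right (coordVector_ne_zero hm)
  have h1 : ContMDiffAt 𝓘(ℂ) 𝓘(ℂ) ω
      (fun m : S => (show ℂ →L[ℂ] ℂ from η m) (tangentCoordChange 𝓘(ℂ) m₀ m m 1)) m₀ :=
    (hη.contMDiffAt m₀).clm_apply contMDiffAt_const
  have h2 : ContMDiffAt 𝓘(ℂ) 𝓘(ℂ) ω F m₀ := by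
    refine h1.congr_of_eventuallyEq ?_
    filter_upwards [c.open_source.mem_nhds hm₀] with m hm
    have := DFunLike.congr_fun (tangentCoordChange_real_eq_complex hm) 1
    exact congrArg (inModel (realForm η) m) this
  have h3 : AnalyticAt ℂ (F ∘ c.symm) (c m₀) := by
    have h := (contMDiffAt_iff.1 h2).2
    simp only [mfld_simps] at h
    exact (contDiffWithinAt_univ.1 h).analyticAt
  have hsource : ∀ᶠ m in nhds m₀, m ∈ c.source := c.open_source.mem_nhds hm₀
  have hc : Filter.Tendsto c (nhds m₀) (nhds (c m₀)) := c.continuousAt hm₀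
  rcases h3.eventually_eq_zero_or_eventually_ne_zero with h | h
  · left
    filter_upwards [hc.eventually h, hsource] with m hm hms
    rw [Function.comp_apply, c.left_inv hms] at hm
    exact (hF m hms).1 hm
  · right
    have hc' : Filter.Tendsto c (nhdsWithin m₀ {m₀}ᶜ) (nhdsWithin (c m₀) {c m₀}ᶜ) := by
      refine tendsto_nhdsWithin_iff.2 ⟨hc.mono_left nhdsWithin_le_nhds, ?_⟩
      filter_upwards [nhdsWithin_le_nhds hsource, self_mem_nhdsWithin] with m hm hne
      exact fun heq => hne (c.injOn hm hm₀ heq)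
    filter_upwards [hc'.eventually h, nhdsWithin_le_nhds hsource] with m hm hms
    rw [Function.comp_apply, c.left_inv hms] at hm
    exact fun h0 => hm ((hF m hms).2 h0)

/-- The identity theorem: on a connected surface a non-zero holomorphic 1-form is non-zero on a
dense set. -/
theorem IsHolomorphicOneForm.dense_ne_zero [ConnectedSpace S] (hη : IsHolomorphicOneForm η)
    (h0 : η ≠ 0) : Dense {m : S | inModel (realForm η) m 1 ≠ 0} := by
  let A : Set S := {m₀ | ∀ᶠ m in nhds m₀, inModel (realForm η) m 1 = 0}
  have hopen : IsOpen A := isOpen_setOfPred_eventually_nhds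
  have hclosed : IsClosed A := by
    rw [← isOpen_compl_iff, isOpen_iff_mem_nhds]
    intro m hm
    have h := (hη.eventually_eq_or_eventually_ne m).resolve_left hm
    rw [eventually_nhdsWithin_iff] at h
    rw [← eventually_eventually_nhds] at h
    filter_upwards [h] with y hy hyA
    by_cases hym : y = m
    · exact hm (hym ▸ hyA)
    · exact hy.self_of_nhds hym (Filter.Eventually.self_of_nhds (p := fun x =>
        inModel (realForm η) x 1 = 0) hyA)
  have hA : A = ∅ := by
    refine (isClopen_iff.1 ⟨hclosed, hopen⟩).resolve_right fun hA => h0 ?_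
    funext m
    have hm : m ∈ A := hA ▸ Set.mem_univ m
    have hm1 : inModel (realForm η) m 1 = 0 :=
      Filter.Eventually.self_of_nhds (p := fun x => inModel (realForm η) x 1 = 0) hm
    have h : ∀ v : ℂ, inModel (realForm η) m v = 0 := fun v => by
      rw [inModel_realForm, hm1, mul_zero]
    exact ContinuousLinearMap.ext h
  intro m
  have hm : m ∉ A := hA ▸ Set.notMem_empty m
  exact mem_closure_iff_frequently.2 fun h => hm (h.mono fun y hy => not_not.1 hy)

end Zeros

/-! ### The pairing -/

section PairingLemmas

variable {S : Type*} [TopologicalSpace S] [ChartedSpace ℂ S] [IsManifold 𝓘(ℂ) ω S]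
  {E : Type*} [NormedAddCommGroup E] [NormedSpace ℂ E]
  {G : Type*} [TopologicalSpace G] [ChartedSpace E G] [Group G]

/-- Forms of type `(0,1)` are conjugate linear. -/
theorem Omega01.apply_eq {V : Type*} [NormedAddCommGroup V] [NormedSpace ℂ V] (ξ : Omega01 S V)
    (m : S) (v : ℂ) : inModel ξ.1 m v = starRingEnd ℂ v • inModel ξ.1 m 1 := by
  have hI : inModel ξ.1 m Complex.I = -(Complex.I • inModel ξ.1 m 1) := by
    have h := ξ.2.2 m (show ℂ from 1)
    have h1 : complexStructure m (show ℂ from 1) = Complex.I := mul_one Complex.I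
    rw [h1] at h
    exact h
  have hv : v = v.re • (1 : ℂ) + v.im • Complex.I := by
    simp [Complex.re_add_im]
  have hc : starRingEnd ℂ v = v.re - v.im * Complex.I := by
    apply Complex.ext <;> simp
  conv_lhs => rw [hv]
  rw [map_add, map_smul, map_smul, hI, hc, sub_smul, mul_smul, smul_neg, sub_eq_add_neg,
    Complex.coe_smul, Complex.coe_smul]

variable [FiniteDimensional ℂ E]

omit [IsManifold 𝓘(ℂ) ω S] in
theorem inModel_formPairing (B : LinearMap.BilinForm ℂ (LieAlg E G)) (α : OneForm S (LieAlg E G))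
    (X : S → LieAlg E G) (m : S) (v : ℂ) :
    inModel (formPairing B α X) m v = B (inModel α m v) (X m) := rfl

theorem isSmoothOneForm_formPairing (B : LinearMap.BilinForm ℂ (LieAlg E G))
    {α : OneForm S (LieAlg E G)} (hα : IsSmoothOneForm α) {X : S → LieAlg E G}
    (hX : ContMDiff 𝓘(ℝ, ℂ) 𝓘(ℝ, LieAlg E G) ∞ X) : IsSmoothOneForm (formPairing B α X) := by
  have : FiniteDimensional ℝ (LieAlg E G) := FiniteDimensional.trans ℝ ℂ (LieAlg E G)
  let T : LieAlg E G →ₗ[ℝ] LieAlg E G →L[ℝ] ℂ :=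
    (ContinuousLinearMap.restrictScalarsₗ ℂ (LieAlg E G) ℂ ℝ ℝ) ∘ₗ
      ((LinearMap.toContinuousLinearMap.toLinearMap ∘ₗ B.flip).restrictScalars ℝ)
  exact hα.comp_clm (A := fun m => LinearMap.toContinuousLinearMap T (X m))
    ((LinearMap.toContinuousLinearMap T).contMDiff.comp hX)

theorem inModel_formPairing_Omega01 (B : LinearMap.BilinForm ℂ (LieAlg E G))
    (ξ : Omega01 S (LieAlg E G)) (X : S → LieAlg E G) (m : S) (v : ℂ) :
    inModel (formPairing B ξ.1 X) m v
      = starRingEnd ℂ v * inModel (formPairing B ξ.1 X) m 1 := by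
  rw [inModel_formPairing, inModel_formPairing, Omega01.apply_eq, map_smul, LinearMap.smul_apply,
    smul_eq_mul]

variable [CompactSpace S] [T2Space S] [LieGroup 𝓘(ℂ, E) ω G]
  {B : LinearMap.BilinForm ℂ (LieAlg E G)} {η : ∀ m : S, TangentSpace 𝓘(ℂ) m →L[ℂ] ℂ}

/-- The invariance of the pairing under `C^∞(S, G)`. -/
theorem pairing_dualAct [LieAlgebra.IsSimple ℂ (LieAlg E G)] (hB : B.Nondegenerate)
    (hB_inv : B.lieInvariant (LieAlg E G)) (hη : IsHolomorphicOneForm η)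
    (f : CurrentGroup S E G) (e : DualSpace S E G) (v : CentralExtension η B) :
    pairing (dualAct e f) v = pairing e (extAct f v) := by
  have h1 : formPairing B (e.1 • dbarLog f + adForm f⁻¹ e.2).1 v.2
      = e.1 • formPairing B (dbarLog f).1 v.2 + formPairing B e.2.1 (adMap f v.2) := by
    funext m
    refine ContinuousLinearMap.ext fun w => ?_
    have h := apply_Ad_inv hB hB_inv (f m) (e.2.1 m w) (v.2 m)
    change B (e.1 • (dbarLog f).1 m w + Ad (f m)⁻¹ (e.2.1 m w)) (v.2 m)
      = e.1 • B ((dbarLog f).1 m w) (v.2 m) + B (e.2.1 m w) (Ad (f m) (v.2 m))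
    rw [map_add, LinearMap.add_apply, map_smul, LinearMap.smul_apply, h]
  have hsm : ∀ (ζ : Omega01 S (LieAlg E G)) (X : CurrentAlg S E G),
      IsSmoothOneForm (formPairing B ζ.1 X) := fun ζ X =>
    isSmoothOneForm_formPairing B ζ.2.1 X.contMDiff
  have hη' := hη.isSmoothOneForm
  have h2 := surfaceIntegral_add
    (isContinuousTwoForm_wedge hη' ((hsm (dbarLog f) v.2).const_smul e.1))
    (isContinuousTwoForm_wedge hη' (hsm e.2 (adMap f v.2)))
  rw [← wedge_add, wedge_smul, surfaceIntegral_smul] at h2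
  simp only [pairing, dualAct, extAct]
  rw [h1, h2]
  ring

omit [LieGroup 𝓘(ℂ, E) ω G] in
theorem surfaceIntegral_wedge_zero (α : OneForm S ℂ) : surfaceIntegral (wedge α 0) = 0 := by
  have h := wedge_smul α 0 0
  rw [zero_smul] at h
  rw [h, surfaceIntegral_smul, zero_mul]

theorem fst_eq_zero_of_pairing_eq_zero_left (e : DualSpace S E G)
    (he : ∀ v : CentralExtension η B, pairing e v = 0) : e.1 = 0 := by
  have h := he ((1, 0) : ℂ × CurrentAlg S E G)
  have h1 : formPairing B e.2.1 (0 : CurrentAlg S E G) = 0 := by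
    funext m
    refine ContinuousLinearMap.ext fun w => ?_
    exact (B (e.2.1 m w)).map_zero
  have h2 : e.1 * 1 - surfaceIntegral (wedge (realForm η)
      (formPairing B e.2.1 (0 : CurrentAlg S E G))) = 0 := h
  rwa [h1, surfaceIntegral_wedge_zero, mul_one, sub_zero] at h2

/-- If `∫ η ∧ ⟨ξ, X⟩` vanishes for all `X`, then so does `η ∧ ξ` at each point. For a partition
function `ρ` and a vector `y`, the coefficient `g` of `η ∧ ⟨ξ, y⟩` in the chart of `ρ` yields a
smooth map `X = ρ ḡ y` on the whole surface, for which the integrand is `ρ |g|²`. -/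
theorem apply_mul_eq_zero_of_surfaceIntegral_eq_zero (hη : IsHolomorphicOneForm η)
    (ξ : Omega01 S (LieAlg E G)) (h0 : ∀ X : CurrentAlg S E G,
      surfaceIntegral (wedge (realForm η) (formPairing B ξ.1 X)) = 0)
    (m : S) (y : LieAlg E G) : inModel (realForm η) m 1 * B (inModel ξ.1 m 1) y = 0 := by
  have hη' := hη.isSmoothOneForm
  have hξy : IsSmoothOneForm (formPairing B ξ.1 fun _ => y) :=
    isSmoothOneForm_formPairing B ξ.2.1 contMDiff_const
  obtain ⟨p, hp⟩ := (chartPartition S).exists_pos_of_mem (Set.mem_univ m)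
  have hmp : m ∈ (chartAt ℂ p).source :=
    chartPartition_isSubordinate p (subset_tsupport _ hp.ne')
  let g : S → ℂ := fun x => inChart (realForm η) p x 1
    * inChart (formPairing B ξ.1 fun _ => y) p x 1
  have hg : ∀ x, g x = Complex.normSq (coordVector p x)
      * (inModel (realForm η) x 1 * B (inModel ξ.1 x 1) y) := fun x => by
    have h1 : g x = inModel (realForm η) x (coordVector p x)
      * inModel (formPairing B ξ.1 fun _ => y) x (coordVector p x) := rfl
    rw [h1, inModel_realForm, inModel_formPairing_Omega01, ← Complex.mul_conj, inModel_formPairing]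
    ring
  have hgs : ∀ x ∈ (chartAt ℂ p).source, ContMDiffAt 𝓘(ℝ, ℂ) 𝓘(ℝ, ℂ) ∞ g x := fun x hx => by
    have h : ∀ {γ : OneForm S ℂ}, IsSmoothOneForm γ →
        ContMDiffAt 𝓘(ℝ, ℂ) 𝓘(ℝ, ℂ) ∞ (fun x => inChart γ p x 1) x := fun hγ =>
      ((hγ.contMDiffOn_inChart p).contMDiffAt ((chartAt ℂ p).open_source.mem_nhds hx)).clm_apply
        contMDiffAt_const
    exact (((ContinuousLinearMap.mul ℝ ℂ).contMDiff.contMDiffAt.comp x (h hη')).clm_apply (h hξy))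
  let C : ℂ →L[ℝ] LieAlg E G :=
    ((ContinuousLinearMap.lsmul ℝ ℂ).flip y).comp (Complex.conjCLE : ℂ →L[ℝ] ℂ)
  let X : CurrentAlg S E G := ⟨fun x => chartPartition S p x • C (g x),
    (chartPartition S).contMDiff_smul fun x hx => C.contMDiff.contMDiffAt.comp x
      (hgs x (chartPartition_isSubordinate p hx))⟩
  have hX : ∀ x, X x = (chartPartition S p x : ℂ) • starRingEnd ℂ (g x) • y := fun x =>
    (Complex.coe_smul _ _).symm
  let r : S → ℝ := fun x => chartPartition S p x * (Complex.normSq (coordVector p x)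
    * Complex.normSq (inModel (realForm η) x 1 * B (inModel ξ.1 x 1) y))
  have hr : ∀ x, 0 ≤ r x := fun x => mul_nonneg ((chartPartition S).nonneg p x)
    (mul_nonneg (Complex.normSq_nonneg _) (Complex.normSq_nonneg _))
  have hrm := eq_zero_of_surfaceIntegral_wedge (inModel_realForm η)
    (inModel_formPairing_Omega01 B ξ X) hη'
    (isSmoothOneForm_formPairing B ξ.2.1 X.contMDiff) hr (fun x => by
      rw [inModel_formPairing, hX, map_smul, map_smul, hg, map_mul, Complex.conj_ofReal]
      simp only [r, smul_eq_mul]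
      push_cast
      rw [← Complex.mul_conj (_ * B _ y)]
      ring) (h0 X) m
  simp only [r] at hrm
  rw [mul_eq_zero, or_iff_right hp.ne', mul_eq_zero,
    or_iff_right (by simpa using coordVector_ne_zero hmp), Complex.normSq_eq_zero] at hrm
  exact hrm

theorem eq_zero_of_pairing_eq_zero_left [ConnectedSpace S] (hB : B.Nondegenerate)
    (hη : IsHolomorphicOneForm η) (hη0 : η ≠ 0) (e : DualSpace S E G)
    (he : ∀ v : CentralExtension η B, pairing e v = 0) : e = 0 := by
  have h1 := fst_eq_zero_of_pairing_eq_zero_left e he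
  have h2 : ∀ X : CurrentAlg S E G,
      surfaceIntegral (wedge (realForm η) (formPairing B e.2.1 X)) = 0 := fun X => by
    have h : e.1 * 0 - surfaceIntegral (wedge (realForm η) (formPairing B e.2.1 X)) = 0 :=
      he ((0, X) : ℂ × CurrentAlg S E G)
    rwa [mul_zero, zero_sub, neg_eq_zero] at h
  have h3 : ∀ m, inModel (realForm η) m 1 ≠ 0 → inModel e.2.1 m = 0 := fun m hm => by
    have h : inModel e.2.1 m 1 = 0 := hB.1 _ fun y =>
      (mul_eq_zero.1 (apply_mul_eq_zero_of_surfaceIntegral_eq_zero hη e.2 h2 m y)).resolve_left hm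
    ext v
    rw [Omega01.apply_eq, h, smul_zero, zero_apply]
  -- `ξ` vanishes on a dense set, hence everywhere by continuity in each chart.
  have h4 : ∀ m, inModel e.2.1 m = 0 := fun m => by
    have hm := mem_chart_source ℂ m
    have hc : ContinuousAt (inChart e.2.1 m) m :=
      (e.2.2.1.contMDiffOn_inChart m).continuousOn.continuousAt
        ((chartAt ℂ m).open_source.mem_nhds hm)
    have hz : inChart e.2.1 m m = 0 := by
      by_contra hne
      obtain ⟨x, hx, hx'⟩ := (hη.dense_ne_zero hη0).inter_nhds_nonempty
        (hc.eventually_ne hne)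
      refine hx' ?_
      rw [inChart, h3 x hx, ContinuousLinearMap.zero_comp]
    ext v
    have h := DFunLike.congr_fun hz v
    rw [inChart, ContinuousLinearMap.comp_apply, tangentCoordChange_self (by simp)] at h
    exact h
  exact Prod.ext h1 (Subtype.ext (funext h4))

/-- For given `X`, the integrand of `∫ η ∧ ⟨ξ, X⟩` is non-negative if `ξ = η̄ ⊗ Y`, where `Y` is the
sum of the `conj ⟨bᵢ, X⟩ bᵢ` over a basis. -/
theorem eq_zero_of_pairing_eq_zero_right [ConnectedSpace S] (hB : B.Nondegenerate)
    (hη : IsHolomorphicOneForm η) (hη0 : η ≠ 0) (v : CentralExtension η B)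
    (hv : ∀ e : DualSpace S E G, pairing e v = 0) : v = 0 := by
  have hη' := hη.isSmoothOneForm
  let X : CurrentAlg S E G := v.2
  have h1 : v.1 = 0 := by
    have h : 1 * v.1 - surfaceIntegral (wedge (realForm η)
      (formPairing B (0 : OneForm S (LieAlg E G)) X)) = 0 := hv (1, 0)
    have h0 : formPairing B (0 : OneForm S (LieAlg E G)) X = 0 := by
      funext m
      refine ContinuousLinearMap.ext fun w => ?_
      exact LinearMap.congr_fun B.map_zero (X m)
    rwa [h0, surfaceIntegral_wedge_zero, one_mul, sub_zero] at h
  let b := Module.finBasis ℂ (LieAlg E G)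
  let L : LieAlg E G →L[ℝ] LieAlg E G := ∑ i, ((ContinuousLinearMap.lsmul ℝ ℂ).flip (b i)).comp
    ((Complex.conjCLE : ℂ →L[ℝ] ℂ).comp
      ((LinearMap.toContinuousLinearMap (B (b i))).restrictScalars ℝ))
  have hL : ∀ x, L x = ∑ i, starRingEnd ℂ (B (b i) x) • b i := fun x => by
    simp only [L, sum_apply]
    rfl
  let ξ₀ : OneForm S (LieAlg E G) := fun m =>
    (((ContinuousLinearMap.lsmul ℝ ℂ).flip (L (X m))).comp
      (Complex.conjCLE : ℂ →L[ℝ] ℂ)).comp (realForm η m)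
  have hξ₀ : ∀ (m : S) (w : ℂ), inModel ξ₀ m w
      = starRingEnd ℂ (inModel (realForm η) m w) • L (X m) := fun m w => rfl
  let ξ : Omega01 S (LieAlg E G) := ⟨ξ₀, hη'.star_smul (L.contMDiff.comp X.contMDiff), fun m w => by
    have h : ∀ w : ℂ, inModel ξ₀ m (Complex.I * w) = -(Complex.I • inModel ξ₀ m w) := fun w => by
      rw [hξ₀, hξ₀, inModel_realForm, inModel_realForm η m w, mul_assoc, map_mul, Complex.conj_I,
        mul_smul, neg_smul]
    exact h w⟩
  have h2 : surfaceIntegral (wedge (realForm η) (formPairing B ξ.1 X)) = 0 := by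
    have h : 0 * v.1 - surfaceIntegral (wedge (realForm η) (formPairing B ξ.1 X)) = 0 := hv (0, ξ)
    rwa [zero_mul, zero_sub, neg_eq_zero] at h
  let r : S → ℝ := fun m => Complex.normSq (inModel (realForm η) m 1)
    * ∑ i, Complex.normSq (B (b i) (X m))
  have hr := eq_zero_of_surfaceIntegral_wedge (r := r) (inModel_realForm η)
    (inModel_formPairing_Omega01 B ξ X) hη' (isSmoothOneForm_formPairing B ξ.2.1 X.contMDiff)
    (fun m => mul_nonneg (Complex.normSq_nonneg _)
      (Finset.sum_nonneg fun i _ => Complex.normSq_nonneg _)) (fun m => by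
      rw [inModel_formPairing, hξ₀, hL, map_smul, LinearMap.smul_apply, map_sum,
        LinearMap.sum_apply, smul_eq_mul, ← mul_assoc, Complex.mul_conj]
      simp only [r]
      push_cast
      congr 1
      refine Finset.sum_congr rfl fun i _ => ?_
      rw [map_smul, LinearMap.smul_apply, smul_eq_mul, mul_comm, Complex.mul_conj]) h2
  have h3 : ∀ m, inModel (realForm η) m 1 ≠ 0 → X m = 0 := fun m hm => by
    have h := (mul_eq_zero.1 (hr m)).resolve_left (by simpa using hm)
    rw [Finset.sum_eq_zero_iff_of_nonneg fun i _ => Complex.normSq_nonneg _] at h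
    refine hB.2 _ fun x => ?_
    have h4 : B.flip (X m) = 0 := b.ext fun i => Complex.normSq_eq_zero.1 (h i (Finset.mem_univ i))
    exact LinearMap.congr_fun h4 x
  have h4 : (X : S → LieAlg E G) = 0 :=
    Continuous.ext_on (hη.dense_ne_zero hη0) X.contMDiff.continuous continuous_zero h3
  exact Prod.ext h1 (ContMDiffMap.ext fun m => congrFun h4 m)

end PairingLemmas

end CurrentAlgebra

end

theorem lemma5p1
    {S : Type*} [TopologicalSpace S] [ChartedSpace ℂ S] [IsManifold 𝓘(ℂ) ω S]
    [CompactSpace S] [T2Space S] [ConnectedSpace S]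
    {E : Type*} [NormedAddCommGroup E] [NormedSpace ℂ E] [FiniteDimensional ℂ E]
    {G : Type*} [TopologicalSpace G] [ChartedSpace E G] [Group G] [LieGroup 𝓘(ℂ, E) ω G]
    [LieAlgebra.IsSimple ℂ (LieAlg E G)]
    (B : LinearMap.BilinForm ℂ (LieAlg E G)) (hB_symm : B.IsSymm) (hB_nondeg : B.Nondegenerate)
    (hB_inv : B.lieInvariant (LieAlg E G))
    (η : ∀ m : S, TangentSpace 𝓘(ℂ) m →L[ℂ] ℂ) (hη : IsHolomorphicOneForm η) :
    ((∀ e : DualSpace S E G, dualAct e 1 = e) ∧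
      ∀ (e : DualSpace S E G) (f h : CurrentGroup S E G),
        dualAct e (f * h) = dualAct (dualAct e f) h) ∧
    (∀ (f : CurrentGroup S E G) (e : DualSpace S E G) (v : CentralExtension η B),
      pairing (dualAct e f) v = pairing e (extAct f v)) ∧
    (η ≠ 0 →
      (∀ e : DualSpace S E G, (∀ v : CentralExtension η B, pairing e v = 0) → e = 0) ∧
      ∀ v : CentralExtension η B, (∀ e : DualSpace S E G, pairing e v = 0) → v = 0) :=
  ⟨⟨dualAct_one, dualAct_mul⟩, pairing_dualAct hB_nondeg hB_inv hη, fun hη0 =>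
    ⟨eq_zero_of_pairing_eq_zero_left hB_nondeg hη hη0,
      eq_zero_of_pairing_eq_zero_right hB_nondeg hη hη0⟩⟩
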